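/- Let $I=[-\tfrac12,\tfrac12]$ with Lebesgue measure $m$, let $I\times I$ carry the sup metric, and let $(X^t)_{t\in\mathbb R}$ be a $C^1$ flow on $\mathbb R^3$ (that is, $(t,x)\mapsto X^t(x)$ is $C^1$). Let $\sigma$ be a $C^1$ embedding of the square $I\times I$ (defined and $C^1$ near it, and injective on it) whose image $\Sigma$ is transversal to the flow, i.e. at every point of $\Sigma$ the two partial derivatives of $\sigma$ and the velocity of the flow are linearly independent. For $p\in\mathbb R^3$ let $t(p)=\inf\{s>0: X^s(p)\in\Sigma\}\in[0,\infty]$ be the return time. Identify $I\times I$ with $\Sigma$ through $\sigma$. Let $F(x,y)=(T(x),G(x,y))$ be a Borel map of $I\times I$ into itself and $\mu_F$ an $F$-invariant Borel probability measure, with marginal $\mu_x$ on the $x$-axis, such that: 1. $T^{-1}(x)$ is finite for each $x\in I$, and there are $C,\kappa>0$ such that for all $n\ge 0$, all Borel $g\in L^1(I,m)$ and all $f:I\to\mathbb R$ of bounded variation, $$\Big|\int g(T^n(x))f(x)\,dm-\int g\,d\mu_x\int f\,dm\Big|\le C\,\|g\|_{L^1}\,\|f\|_{BV}\,e^{-\kappa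 n},\qquad \|f\|_{BV}=\|f\|_{L^1}+\operatorname{var}f;$$ 2. there is $\lambda<1$ such that $y\mapsto G(x,y)$ is $\lambda$-Lipschitz for each $x\in I$; 3. there is $K\ge0$ such that for every Lipschitz $f:I\times I\to\mathbb R$, with Lipschitz constant $\ell$, the projection to the $x$-axis of the signed measure $f\mu_F$ has a density $\overline f$ of bounded variation with $\operatorname{var}(\overline f)\le K(\|f\|_\infty+\ell)$. Suppose that $F$ is the first return map of the flow, i.e. for $\mu_F$-almost every $w$ one has $t(w)<\infty$ and $X^{t(w)}(w)=F(w)$, and that the return time is integrable, $\int t\,d\mu_F<\infty$. Let $\mu_X$ be the measure on $\mathbb R^3$ which is the image of the restriction of $\mu_F\times ds$ to $\{(w,s):0\le s<t(w)\}$ under $(w,s)\mapsto X^s(w)$ (a finite invariant measure of the flow; normalizing it changes nothing below). Let $\mathcal B=\{X^s(w):w\in\Sigma,\ s\ge 0\}$. Call $x_0\in\mathbb R^3$ regular if there are $y_0\in\Sigma$ and $t_0\ge0$ with $X^{t_0}(y_0)=x_0$ such that $(w,s)\mapsto X^s(w)$ maps a neighbourhood $U$ of $(y_0,t_0)$ in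 $\Sigma\times\mathbb R$ onto a set which contains all points of $\mathcal B$ near $x_0$, diffeomorphically in the sense that some map $\psi:\mathbb R^3\to\mathbb R^2\times\mathbb R$ which is $C^1$ near $x_0$ satisfies $\psi(X^s(\sigma(v)))=(v,s)$ for all $(\sigma(v),s)\in U$. (Every $X^{t_0}(y_0)$ with $t_0\geq 0$ and $y_0$ in the relative interior of $\Sigma$ is regular.) Let $B_r(x_0)$ be the closed Euclidean ball, $\tau_r(x,x_0)=\inf\{s\ge0:X^s(x)\in B_r(x_0)\}\in[0,\infty]$, and $d_{\mu_X}(x_0)=\lim_{r\to0}\frac{\log\mu_X(B_r(x_0))}{\log r}$ (limit in $[-\infty,\infty]$, with $\log0=-\infty$, $\log\infty=\infty$). Then for every regular $x_0$ for which the limit $d_{\mu_X}(x_0)$ exists, $$\lim_{r\to0}\frac{\log\tau_r(x,x_0)}{-\log r}=d_{\mu_X}(x_0)-1\qquad\text{for }\mu_X\text{-almost every }x\in\mathbb R^3 .$$ -/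

import Mathlib

open MeasureTheory Set Filter Topology
open scoped ENNReal NNReal

noncomputable section

namespace LorenzFlow

/-- Euclidean three-space. -/
abbrev E3 : Type := EuclideanSpace ℝ (Fin 3)

/-- The interval `I = [-1/2, 1/2]`. -/
abbrev Interval : Type := Set.Icc (-(1 / 2) : ℝ) (1 / 2)

/-- Lebesgue measure on `I`. -/
def leb : Measure Interval := (volume : Measure ℝ).comap Subtype.val

/-- The abstract square `I × I`, with the sup metric. -/
abbrev Square : Type := Interval × Interval

/-- The square as a subset of the plane `ℝ × ℝ`. -/
def planeSquare : Set (ℝ × ℝ) :=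
  Set.Icc (-(1 / 2) : ℝ) (1 / 2) ×ˢ Set.Icc (-(1 / 2) : ℝ) (1 / 2)

/-- The inclusion of the square in the plane. -/
def toPlane (w : Square) : ℝ × ℝ := (w.1, w.2)

/-! ### Two dimensional maps preserving the vertical foliation -/

/-- The map `F(x, y) = (T x, G(x, y))` of the square. -/
def skewMap (T : Interval → Interval) (G : Square → Interval) (w : Square) : Square :=
  (T w.1, G w)

/-- The norm `‖f‖_BV = ‖f‖_{L¹} + var f` of a function on `I`. -/
def bvNorm (f : Interval → ℝ) : ℝ :=
  (∫ x, |f x| ∂leb) + (eVariationOn f Set.univ).toReal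

/-- Exponential decay of correlations of `(T, ν)` for `L¹` against bounded variation observables:
`|∫ g(Tⁿ x) f(x) dm - ∫ g dν ∫ f dm| ≤ C ‖g‖_{L¹} ‖f‖_BV e^{-κ n}` with `m` Lebesgue measure. -/
def HasL1BVDecay (T : Interval → Interval) (ν : Measure Interval) : Prop :=
  ∃ C : ℝ, 0 < C ∧ ∃ κ : ℝ, 0 < κ ∧
    ∀ g : Interval → ℝ, Measurable g → Integrable g leb →
    ∀ f : Interval → ℝ, BoundedVariationOn f Set.univ →
    ∀ n : ℕ,
      |(∫ x, g (T^[n] x) * f x ∂leb) - (∫ x, g x ∂ν) * (∫ x, f x ∂leb)|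
        ≤ C * (∫ x, |g x| ∂leb) * bvNorm f * Real.exp (-(κ * n))

/-- Regularity of `μ` along the vertical foliation: for every Lipschitz `f` on the square the
projection to the `x`-axis of the signed measure `f μ` has a density `fbar` of bounded variation,
with variation at most `K (‖f‖_∞ + Lip f)`. -/
def HasBVProjections (μ : Measure Square) : Prop :=
  ∃ K : ℝ, 0 ≤ K ∧
    ∀ (ℓ : ℝ≥0) (b : ℝ) (f : Square → ℝ), LipschitzWith ℓ f → (∀ w, |f w| ≤ b) →
      ∃ fbar : Interval → ℝ, BoundedVariationOn fbar Set.univ ∧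
        (∀ A : Set Interval, MeasurableSet A →
          ∫ w in Prod.fst ⁻¹' A, f w ∂μ = ∫ x in A, fbar x ∂leb) ∧
        (eVariationOn fbar Set.univ).toReal ≤ K * (b + ℓ)

/-- The assumptions on a two dimensional Lorenz like map `F = (T, G)` and its invariant
probability measure `μ`. -/
structure IsLorenzLikeMap (T : Interval → Interval) (G : Square → Interval)
    (μ : Measure Square) : Prop where
  measurable : Measurable (skewMap T G)
  isProbability : IsProbabilityMeasure μ
  invariant : μ.map (skewMap T G) = μ
  finite_fibers : ∀ x : Interval, (T ⁻¹' {x}).Finite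
  base_decay : HasL1BVDecay T (μ.map Prod.fst)
  leaf_contraction : ∃ lam : ℝ≥0, lam < 1 ∧
    ∀ x : Interval, LipschitzWith lam (fun y : Interval => G (x, y))
  bv_projections : HasBVProjections μ

/-! ### Flows with a transversal section -/

/-- The flow map `(w, t) ↦ X^t (σ w)` issued from the section `σ`. -/
def sectionFlow (X : Flow ℝ E3) (σ : ℝ × ℝ → E3) (q : (ℝ × ℝ) × ℝ) : E3 := X q.2 (σ q.1)

/-- `X` is a `C¹` flow: `(t, x) ↦ X^t x` is continuously differentiable. -/
def IsC1Flow (X : Flow ℝ E3) : Prop :=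
  ContDiff ℝ 1 (fun p : ℝ × E3 => X p.1 p.2)

/-- The vector field generating the flow. -/
def velocity (X : Flow ℝ E3) (p : E3) : E3 := deriv (fun t : ℝ => X t p) 0

/-- `σ` parametrizes a `C¹` embedded square in space which is transversal to the flow:
at each of its points the derivative of `σ` and the velocity together span the space. -/
structure IsTransversalSection (X : Flow ℝ E3) (σ : ℝ × ℝ → E3) : Prop where
  contDiffAt : ∀ w ∈ planeSquare, ContDiffAt ℝ 1 σ w
  injOn : Set.InjOn σ planeSquare
  transversal : ∀ w ∈ planeSquare, Function.Injective
    (fun q : (ℝ × ℝ) × ℝ => fderiv ℝ σ w q.1 + q.2 • velocity X (σ w))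

/-- The return time of `p` to the section: the infimum of the strictly positive times at which the
orbit of `p` meets the section (`∞` if there is none). -/
def returnTime (X : Flow ℝ E3) (σ : ℝ × ℝ → E3) (p : E3) : ℝ≥0∞ :=
  ⨅ (t : ℝ) (_ : 0 < t ∧ X t p ∈ σ '' planeSquare), ENNReal.ofReal t

/-- `F` is the first return map of the flow to the section, `μ`-almost everywhere. -/
def IsFirstReturnMap (X : Flow ℝ E3) (σ : ℝ × ℝ → E3) (F : Square → Square)
    (μ : Measure Square) : Prop :=
  ∀ᵐ w ∂μ, returnTime X σ (σ (toPlane w)) < ∞ ∧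
    X (returnTime X σ (σ (toPlane w))).toReal (σ (toPlane w)) = σ (toPlane (F w))

/-- The invariant measure of the flow built from the invariant measure `μ` of the first return map:
the image under `(w, s) ↦ X^s (σ w)` of `μ × ds` on the fundamental domain
`{(w, s) : 0 ≤ s < t(w)}` of the suspension over the section. -/
def flowMeasure (X : Flow ℝ E3) (σ : ℝ × ℝ → E3) (μ : Measure Square) : Measure E3 :=
  ((μ.prod (volume : Measure ℝ)).restrict
    {q | 0 ≤ q.2 ∧ ENNReal.ofReal q.2 < returnTime X σ (σ (toPlane q.1))}).map
    (fun q => X q.2 (σ (toPlane q.1)))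

/-- The set of all forward orbits of points of the section. -/
def orbitSpace (X : Flow ℝ E3) (σ : ℝ × ℝ → E3) : Set E3 :=
  {p | ∃ w ∈ planeSquare, ∃ t : ℝ, 0 ≤ t ∧ X t (σ w) = p}

/-- `x₀` is regular: it lies at a time `t₀ ≥ 0` on the orbit of a point `y₀ = σ w₀` of the section,
and the flow induces a diffeomorphism (a map with a `C¹` left inverse `ψ`) from a neighbourhood of
`(w₀, t₀)` in `square × ℝ` onto a set containing all points near `x₀` of the space on which the
flow acts. This holds in particular for every `x₀ = X^{t₀} (σ w₀)` with `w₀` interior to the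
square. -/
def IsRegularPoint (X : Flow ℝ E3) (σ : ℝ × ℝ → E3) (x₀ : E3) : Prop :=
  ∃ w₀ ∈ planeSquare, ∃ t₀ : ℝ, 0 ≤ t₀ ∧ X t₀ (σ w₀) = x₀ ∧
    ∃ U ∈ 𝓝[planeSquare ×ˢ (Set.univ : Set ℝ)] (w₀, t₀), U ⊆ planeSquare ×ˢ Set.univ ∧
      sectionFlow X σ '' U ∈ 𝓝[orbitSpace X σ] x₀ ∧
      ∃ ψ : E3 → (ℝ × ℝ) × ℝ, ContDiffAt ℝ 1 ψ x₀ ∧ ∀ q ∈ U, ψ (sectionFlow X σ q) = q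

/-- The hitting time `τ_r(x, x₀) = inf {t ≥ 0 : X^t x ∈ B_r(x₀)}` (`∞` if the ball is not hit). -/
def hittingTime (X : Flow ℝ E3) (r : ℝ) (x x₀ : E3) : ℝ≥0∞ :=
  ⨅ (t : ℝ) (_ : 0 ≤ t ∧ X t x ∈ Metric.closedBall x₀ r), ENNReal.ofReal t

/-- The local dimension of `μ` at `x` exists and equals `d`: `log μ(B_r(x)) / log r → d` as
`r → 0`, in the extended reals, with `log 0 = -∞`. -/
def HasLocalDimension (μ : Measure E3) (x : E3) (d : EReal) : Prop :=
  Tendsto (fun r : ℝ => ENNReal.log (μ (Metric.closedBall x r)) / ((Real.log r : ℝ) : EReal))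
    (𝓝[>] 0) (𝓝 d)

end LorenzFlow

end

/-! ### Decay of correlations of the skew product -/

namespace LorenzFlow

/-! The problem reduces to hitting times of the return map `F`. By invariance of the flow measure, a
ball around `x₀` can be moved back to the section by the time `t₀`. Up to constants it then becomes
a flow box: a ball of the section around `w₀` times a time interval of comparable length. Hence
`μ(B_r(w₀))` behaves like the flow measure of `B_r(x₀)` divided by `r`, with local exponent `d - 1`
(`exists_mul_measure_le_flowMeasure`, `flowMeasure_closedBall_le`).

Lower bound: few orbits reach `B_r(w₀)` within substantially fewer than `1 / μ(B_r(w₀))` returns, by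
a union bound and Borel–Cantelli (`ae_eventually_forall_notMem`). Transversality and compactness
bound return times below, so many returns take a long time.

Upper bound: leaf contraction and the bounded variation projections lift the decay of correlations
from `T` to Lipschitz observables of `F` (`IsLorenzLikeMap.exists_decay`). Chebyshev's inequality
for bump functions at `w₀`, with Borel–Cantelli, makes almost every orbit hit within slightly more
than `1 / μ(B_r(w₀))` returns (`ae_eventually_exists_pos`). The time these returns take is
controlled by Markov's inequality and integrability of the return time (`ae_eventually_sum_le`).

The almost sure statements are made along dyadic radii, monotonicity in `r` extends them to all
radii, and countably many rational thresholds give the limit. -/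

instance isProbabilityMeasure_leb : IsProbabilityMeasure leb := by
  constructor
  rw [leb, Measure.comap_apply _ Subtype.val_injective
    (fun s hs => MeasurableSet.subtype_image measurableSet_Icc hs) _ MeasurableSet.univ]
  rw [image_univ, Subtype.range_coe, Real.volume_Icc]
  norm_num

lemma leb_singleton (x : Interval) : leb {x} = 0 := by
  rw [leb, Measure.comap_apply _ Subtype.val_injective
    (fun s hs => MeasurableSet.subtype_image measurableSet_Icc hs) _ (measurableSet_singleton x)]
  simp

/-- By the Jordan decomposition, the function is a difference of two monotone, hence Borel,
functions. -/
lemma _root_.BoundedVariationOn.measurable_of_univ {α : Type*} [LinearOrder α]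
    [TopologicalSpace α] [OrderTopology α] [SecondCountableTopology α] [MeasurableSpace α]
    [BorelSpace α] {f : α → ℝ} (hf : BoundedVariationOn f univ) : Measurable f := by
  obtain ⟨p, q, hp, hq, rfl⟩ :=
    hf.locallyBoundedVariationOn.exists_monotoneOn_sub_monotoneOn
  exact (monotoneOn_univ.1 hp).measurable.sub (monotoneOn_univ.1 hq).measurable

lemma _root_.BoundedVariationOn.integrable_leb {f : Interval → ℝ}
    (hf : BoundedVariationOn f univ) : Integrable f leb := by
  have h0 : (0 : ℝ) ∈ Icc (-(1 / 2) : ℝ) (1 / 2) := by constructor <;> norm_num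
  refine Integrable.of_bound hf.measurable_of_univ.aestronglyMeasurable
    (|f ⟨0, h0⟩| + (eVariationOn f univ).toReal) (Eventually.of_forall fun x => ?_)
  have := hf.dist_le (mem_univ x) (mem_univ ⟨0, h0⟩)
  rw [Real.dist_eq] at this
  rw [Real.norm_eq_abs]
  have h2 := abs_sub_abs_le_abs_sub (f x) (f ⟨0, h0⟩)
  linarith

variable {T : Interval → Interval} {G : Square → Interval} {μ : Measure Square}

lemma skewMap_iterate_fst (n : ℕ) (w : Square) : ((skewMap T G)^[n] w).1 = T^[n] w.1 := by
  induction n generalizing w with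
  | zero => rfl
  | succ n ih => rw [Function.iterate_succ_apply, ih, Function.iterate_succ_apply]; rfl

/-- Points of one vertical leaf share their base coordinate forever, so only heights differ. Heights
start at most `1` apart and contract by `lam` at each step. -/
lemma dist_skewMap_iterate_le {lam : ℝ≥0}
    (hG : ∀ x : Interval, LipschitzWith lam (fun y : Interval => G (x, y)))
    (n : ℕ) (x y y' : Interval) :
    dist ((skewMap T G)^[n] (x, y)) ((skewMap T G)^[n] (x, y')) ≤ (lam : ℝ) ^ n := by
  have key : dist ((skewMap T G)^[n] (x, y)).2 ((skewMap T G)^[n] (x, y')).2 ≤ (lam : ℝ) ^ n := by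
    induction n with
    | zero =>
      simp only [Function.iterate_zero, id, pow_zero]
      rw [Subtype.dist_eq, Real.dist_eq, abs_le]
      have := y.2.1; have := y.2.2; have := y'.2.1; have := y'.2.2
      constructor <;> linarith
    | succ n ih =>
      rw [Function.iterate_succ_apply', Function.iterate_succ_apply']
      have h1 : ((skewMap T G)^[n] (x, y')).1 = ((skewMap T G)^[n] (x, y)).1 := by
        rw [skewMap_iterate_fst, skewMap_iterate_fst]
      have h2 := (hG ((skewMap T G)^[n] (x, y)).1).dist_le_mul
        ((skewMap T G)^[n] (x, y)).2 ((skewMap T G)^[n] (x, y')).2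
      have h3 : (skewMap T G ((skewMap T G)^[n] (x, y'))).2
          = G (((skewMap T G)^[n] (x, y)).1, ((skewMap T G)^[n] (x, y')).2) := by
        rw [← h1]; rfl
      rw [h3, pow_succ']
      exact h2.trans (by gcongr)
  rw [Prod.dist_eq, skewMap_iterate_fst, skewMap_iterate_fst]
  simp only [dist_self]
  exact max_le (by positivity) key

lemma IsLorenzLikeMap.measurePreserving (hF : IsLorenzLikeMap T G μ) :
    MeasurePreserving (skewMap T G) μ μ :=
  ⟨hF.measurable, hF.invariant⟩

lemma IsLorenzLikeMap.measurable_base (hF : IsLorenzLikeMap T G μ) : Measurable T := by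
  have h0 : (0 : ℝ) ∈ Icc (-(1 / 2) : ℝ) (1 / 2) := by constructor <;> norm_num
  have : T = fun x => (skewMap T G (x, ⟨0, h0⟩)).1 := rfl
  rw [this]
  exact measurable_fst.comp (hF.measurable.comp (by fun_prop))

/-- Integration of a base observable against `f μ`, for nonnegative `f`, in terms of the projected
density of `f μ`. -/
lemma integral_comp_fst_mul_eq [IsProbabilityMeasure μ] {f : Square → ℝ} (hfm : Measurable f)
    (hf0 : ∀ w, 0 ≤ f w) (hf1 : ∀ w, f w ≤ 1) {fbar : Interval → ℝ}
    (hbv : BoundedVariationOn fbar univ)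
    (h : ∀ A : Set Interval, MeasurableSet A →
      ∫ w in Prod.fst ⁻¹' A, f w ∂μ = ∫ x in A, fbar x ∂leb)
    {g : Interval → ℝ} (hg : Measurable g) :
    0 ≤ᵐ[leb] fbar ∧ ∫ w, g w.1 * f w ∂μ = ∫ x, g x * fbar x ∂leb := by
  have hfi : Integrable f μ := Integrable.of_bound hfm.aestronglyMeasurable 1
    (Eventually.of_forall fun w => by rw [Real.norm_eq_abs, abs_of_nonneg (hf0 w)]; exact hf1 w)
  have hbi := hbv.integrable_leb
  have hbm := hbv.measurable_of_univ
  -- As `f ≥ 0`, the density has nonnegative integral over every Borel set. Both weights thus define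
  -- genuine measures, and equality of these measures gives the formula for any measurable `g`.
  have hpos : 0 ≤ᵐ[leb] fbar := by
    refine ae_nonneg_of_forall_setIntegral_nonneg hbi fun s hs _ => ?_
    rw [← h s hs]
    exact integral_nonneg hf0
  refine ⟨hpos, ?_⟩
  have hmeas : (μ.withDensity (fun w => ENNReal.ofReal (f w))).map Prod.fst
      = leb.withDensity (fun x => ENNReal.ofReal (fbar x)) := by
    ext A hA
    rw [Measure.map_apply measurable_fst hA, withDensity_apply _ (measurable_fst hA),
      withDensity_apply _ hA,
      ← ofReal_integral_eq_lintegral_ofReal hfi.integrableOn (Eventually.of_forall hf0),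
      ← ofReal_integral_eq_lintegral_ofReal hbi.integrableOn (ae_restrict_of_ae hpos), h A hA]
  have e1 : ∫ x, g x ∂((μ.withDensity (fun w => ENNReal.ofReal (f w))).map Prod.fst)
      = ∫ w, g w.1 * f w ∂μ := by
    rw [integral_map measurable_fst.aemeasurable hg.aestronglyMeasurable,
      integral_withDensity_eq_integral_toReal_smul (by fun_prop) (by simp)]
    refine integral_congr_ae (Eventually.of_forall fun w => ?_)
    simp [ENNReal.toReal_ofReal (hf0 w), mul_comm]
  have e2 : ∫ x, g x ∂(leb.withDensity (fun x => ENNReal.ofReal (fbar x)))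
      = ∫ x, g x * fbar x ∂leb := by
    rw [integral_withDensity_eq_integral_toReal_smul (by fun_prop) (by simp)]
    refine integral_congr_ae (hpos.mono fun x hx => ?_)
    simp only [smul_eq_mul, ENNReal.toReal_ofReal hx, mul_comm]
  rw [← e1, hmeas, e2]

/-- The projection of `μ` is absolutely continuous, so `μ` has no atoms. -/
lemma IsLorenzLikeMap.measure_singleton (hF : IsLorenzLikeMap T G μ) (w : Square) :
    μ {w} = 0 := by
  have := hF.isProbability
  obtain ⟨K, -, hK⟩ := hF.bv_projections
  obtain ⟨fbar, -, h, -⟩ := hK 0 1 (fun _ => 1) (LipschitzWith.const 1) (by simp)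
  have h1 := h {w.1} (measurableSet_singleton _)
  rw [Measure.restrict_eq_zero.2 (leb_singleton w.1)] at h1
  simp only [integral_const, smul_eq_mul, mul_one, integral_zero_measure, measureReal_def,
    Measure.restrict_apply_univ] at h1
  have h2 : μ (Prod.fst ⁻¹' {w.1}) = 0 := by
    rcases (ENNReal.toReal_eq_zero_iff _).1 h1 with h | h
    · exact h
    · exact absurd h (measure_ne_top _ _)
  exact measure_mono_null (by rintro _ rfl; rfl) h2

/-- Exponential decay of autocorrelations of `F` for nonnegative Lipschitz observables. -/
lemma IsLorenzLikeMap.exists_decay (hF : IsLorenzLikeMap T G μ) :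
    ∃ C ρ : ℝ, 0 ≤ C ∧ 0 ≤ ρ ∧ ρ < 1 ∧ ∀ (ℓ : ℝ≥0) (f : Square → ℝ), LipschitzWith ℓ f →
      (∀ w, 0 ≤ f w) → (∀ w, f w ≤ 1) → ∀ n : ℕ,
      |(∫ w, f w * f ((skewMap T G)^[n] w) ∂μ) - (∫ w, f w ∂μ) ^ 2|
        ≤ C * (1 + ℓ) * ρ ^ (n / 2) := by
  have := hF.isProbability
  obtain ⟨K, hK0, hK⟩ := hF.bv_projections
  obtain ⟨C, hC0, κ, hκ, hdec⟩ := hF.base_decay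
  obtain ⟨lam, hlam, hG⟩ := hF.leaf_contraction
  have h0 : (0 : ℝ) ∈ Icc (-(1 / 2) : ℝ) (1 / 2) := by constructor <;> norm_num
  set F := skewMap T G with hFdef
  -- The `2` pays for two replacements of `f` by a function of the base, the rest for the base decay
  -- with `bvNorm fbar ≤ 1 + K * (1 + ℓ)`. The rate is the slower of leaf contraction and base
  -- decay.
  refine ⟨2 + C * (1 + K), max lam (Real.exp (-κ)), by positivity, by positivity,
    max_lt (by exact_mod_cast hlam) (by simpa using hκ), ?_⟩
  intro ℓ f hLip hf0 hf1 n
  set ρ : ℝ := max lam (Real.exp (-κ)) with hρ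
  have hρ0 : 0 ≤ ρ := by positivity
  have hρ1 : ρ < 1 := max_lt (by exact_mod_cast hlam) (by simpa using hκ)
  obtain ⟨fbar, hbv, hproj, hvar⟩ := hK ℓ 1 f hLip
    (fun w => by rw [abs_of_nonneg (hf0 w)]; exact hf1 w)
  have hfm : Measurable f := hLip.continuous.measurable
  have hFm : ∀ k, Measurable (F^[k]) := fun k => hF.measurable.iterate k
  have hTm : ∀ k, Measurable (T^[k]) := fun k => hF.measurable_base.iterate k
  -- The time is split: the last `a` steps contract the leaves, the first `b ≥ a` decorrelate the
  -- base.
  set a := n / 2 with ha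
  set b := n - n / 2 with hb
  have hab : n = a + b := by omega
  -- After `a` steps the initial height hardly matters, so it is frozen at `0`.
  let g : Interval → ℝ := fun x => f (F^[a] (x, ⟨0, h0⟩))
  have hgm : Measurable g := hfm.comp ((hFm a).comp (by fun_prop))
  have hg0 : ∀ x, 0 ≤ g x := fun x => hf0 _
  have hg1 : ∀ x, g x ≤ 1 := fun x => hf1 _
  have hgi : Integrable g leb := Integrable.of_bound hgm.aestronglyMeasurable 1
    (Eventually.of_forall fun w => by rw [Real.norm_eq_abs, abs_of_nonneg (hg0 w)]; exact hg1 w)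
  have hclose : ∀ w : Square, |f (F^[a] w) - g w.1| ≤ ℓ * ρ ^ a := by
    intro w
    have h1 := hLip.dist_le_mul (F^[a] w) (F^[a] (w.1, ⟨0, h0⟩))
    have h2 := dist_skewMap_iterate_le (T := T) hG a w.1 w.2 ⟨0, h0⟩
    rw [Real.dist_eq] at h1
    refine h1.trans ?_
    have : (lam : ℝ) ^ a ≤ ρ ^ a := pow_le_pow_left₀ lam.2 (le_max_left _ _) a
    have h3 := h2.trans this
    gcongr
  have bdd : ∀ u : Square → ℝ, Measurable u → (∀ w, 0 ≤ u w) → (∀ w, u w ≤ 1) →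
      Integrable u μ := fun u hu hu0 hu1 => Integrable.of_bound hu.aestronglyMeasurable 1
    (Eventually.of_forall fun w => by rw [Real.norm_eq_abs, abs_of_nonneg (hu0 w)]; exact hu1 w)
  have hfi := bdd f hfm hf0 hf1
  have hm0 : 0 ≤ ∫ w, f w ∂μ := integral_nonneg hf0
  have hm1 : ∫ w, f w ∂μ ≤ 1 := by
    have := integral_mono hfi (integrable_const (1 : ℝ)) hf1
    simpa using this
  have habs_le : ∀ u v : Square → ℝ, Integrable u μ → Integrable v μ →
      (∀ w, |u w - v w| ≤ ℓ * ρ ^ a) → |∫ w, u w ∂μ - ∫ w, v w ∂μ| ≤ ℓ * ρ ^ a := by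
    intro u v hu hv huv
    rw [← integral_sub hu hv]
    have := norm_integral_le_of_norm_le_const (μ := μ) (f := fun w => u w - v w)
      (C := ℓ * ρ ^ a) (Eventually.of_forall huv)
    simpa using this
  -- replace `f ∘ F^[n]` by a function of the base coordinate
  have e1 : |(∫ w, f w * f (F^[n] w) ∂μ) - ∫ w, g (T^[b] w.1) * f w ∂μ| ≤ ℓ * ρ ^ a := by
    refine habs_le _ _ ?_ ?_ ?_
    · exact bdd _ (hfm.mul (hfm.comp (hFm n))) (fun w => mul_nonneg (hf0 _) (hf0 _))
        (fun w => mul_le_one₀ (hf1 _) (hf0 _) (hf1 _))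
    · exact bdd _ ((hgm.comp ((hTm b).comp measurable_fst)).mul hfm)
        (fun w => mul_nonneg (hg0 _) (hf0 _)) (fun w => mul_le_one₀ (hg1 _) (hf0 _) (hf1 _))
    · intro w
      have h1 := hclose (F^[b] w)
      rw [← Function.iterate_add_apply, ← hab, skewMap_iterate_fst] at h1
      rw [mul_comm (g _), ← mul_sub, abs_mul, abs_of_nonneg (hf0 w)]
      exact (mul_le_of_le_one_left (abs_nonneg _) (hf1 w)).trans h1
  obtain ⟨hpos, e2⟩ := integral_comp_fst_mul_eq hfm hf0 hf1 hbv hproj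
    (hgm.comp (hTm b))
  have e3 : ∫ x, fbar x ∂leb = ∫ w, f w ∂μ := by
    have := hproj univ MeasurableSet.univ
    simpa using this.symm
  have hbn : bvNorm fbar ≤ 1 + K * (1 + ℓ) := by
    unfold bvNorm
    have : ∫ x, |fbar x| ∂leb = ∫ x, fbar x ∂leb :=
      integral_congr_ae (hpos.mono fun x hx => abs_of_nonneg hx)
    rw [this, e3]
    linarith
  have hgL : ∫ x, |g x| ∂leb ≤ 1 := by
    have := integral_mono hgi.abs (integrable_const (1 : ℝ))
      (fun x => by rw [abs_of_nonneg (hg0 x)]; exact hg1 x)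
    simpa using this
  have e4 := hdec g hgm hgi fbar hbv b
  rw [e3] at e4
  have e5 : ∫ x, g x ∂(μ.map Prod.fst) = ∫ w, g w.1 ∂μ :=
    integral_map measurable_fst.aemeasurable hgm.aestronglyMeasurable
  rw [e5] at e4
  have e6 : |∫ w, g w.1 ∂μ - ∫ w, f w ∂μ| ≤ ℓ * ρ ^ a := by
    have hinv : ∫ w, f (F^[a] w) ∂μ = ∫ w, f w ∂μ := by
      have hp := hF.measurePreserving.iterate a
      have := integral_map (μ := μ) hp.measurable.aemeasurable
        (f := f) hfm.aestronglyMeasurable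
      rw [hp.map_eq] at this
      exact this.symm
    rw [← hinv]
    refine habs_le _ _ (bdd _ (hgm.comp measurable_fst) (fun _ => hg0 _) (fun _ => hg1 _))
      (bdd _ (hfm.comp (hFm a)) (fun _ => hf0 _) (fun _ => hf1 _)) (fun w => ?_)
    rw [abs_sub_comm]; exact hclose w
  have e7 : C * (∫ x, |g x| ∂leb) * bvNorm fbar * Real.exp (-(κ * b))
      ≤ C * (1 + K * (1 + ℓ)) * ρ ^ a := by
    have hexp : Real.exp (-(κ * b)) ≤ ρ ^ a := by
      have : Real.exp (-(κ * b)) = Real.exp (-κ) ^ b := by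
        rw [← Real.exp_nat_mul]; ring_nf
      rw [this]
      calc Real.exp (-κ) ^ b ≤ ρ ^ b := pow_le_pow_left₀ (Real.exp_nonneg _) (le_max_right _ _) b
        _ ≤ ρ ^ a := pow_le_pow_of_le_one hρ0 hρ1.le (by omega)
    have hbn0 : 0 ≤ bvNorm fbar :=
      add_nonneg (integral_nonneg fun _ => abs_nonneg _) ENNReal.toReal_nonneg
    calc C * (∫ x, |g x| ∂leb) * bvNorm fbar * Real.exp (-(κ * b))
        ≤ C * 1 * (1 + K * (1 + ℓ)) * ρ ^ a := by gcongr
      _ = _ := by ring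
  have e8 : |(∫ w, g w.1 ∂μ) * (∫ w, f w ∂μ) - (∫ w, f w ∂μ) ^ 2| ≤ ℓ * ρ ^ a := by
    rw [sq, ← sub_mul, abs_mul, abs_of_nonneg hm0]
    exact (mul_le_of_le_one_right (abs_nonneg _) hm1).trans e6
  have e9 := e4.trans e7
  simp only [Function.comp_apply] at e2
  rw [← e2] at e9
  have hρa : 0 ≤ ρ ^ a := by positivity
  have hℓ : (0 : ℝ) ≤ ℓ := ℓ.2
  have tri := abs_add_three ((∫ w, f w * f (F^[n] w) ∂μ) - ∫ w, g (T^[b] w.1) * f w ∂μ)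
    ((∫ w, g (T^[b] w.1) * f w ∂μ) - (∫ w, g w.1 ∂μ) * ∫ w, f w ∂μ)
    ((∫ w, g w.1 ∂μ) * (∫ w, f w ∂μ) - (∫ w, f w ∂μ) ^ 2)
  rw [show ∀ x y z t : ℝ, x - y + (y - z) + (z - t) = x - t by intros; ring] at tri
  refine tri.trans ?_
  calc _ ≤ ℓ * ρ ^ a + C * (1 + K * (1 + ℓ)) * ρ ^ a + ℓ * ρ ^ a := by gcongr
    _ = (2 * ℓ + C * (1 + K * (1 + ℓ))) * ρ ^ a := by ring
    _ ≤ (2 + C * (1 + K)) * (1 + ℓ) * ρ ^ a := by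
        gcongr
        nlinarith [mul_nonneg hC0.le hℓ, mul_nonneg hK0 hℓ]

end LorenzFlow

/-! ### Hitting times of measure preserving maps with decay of correlations -/

namespace LorenzFlow

section Discrete

variable {α : Type*} [MeasurableSpace α] {μ : Measure α} {F : α → α}

lemma integral_comp_iterate (hF : MeasurePreserving F μ μ) {f : α → ℝ} (hf : Measurable f)
    (n : ℕ) : ∫ w, f (F^[n] w) ∂μ = ∫ w, f w ∂μ := by
  have hp := hF.iterate n
  have := integral_map (μ := μ) hp.measurable.aemeasurable (f := f) hf.aestronglyMeasurable
  rw [hp.map_eq] at this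
  exact this.symm

/-- Birkhoff sums of an integrable function over times `N j` are at most `δ ^ j N j`, `δ > 1`. -/
lemma ae_eventually_sum_le (hF : MeasurePreserving F μ μ) {t : α → ℝ≥0∞} (ht : Measurable t)
    (hint : ∫⁻ w, t w ∂μ ≠ ∞) {δ : ℝ} (hδ : 1 < δ) {N : ℕ → ℕ} (hN : ∀ j, 0 < N j) :
    ∀ᵐ w ∂μ, ∀ᶠ j in atTop,
      ∑ k ∈ Finset.range (N j), t (F^[k] w) < ENNReal.ofReal (δ ^ j * N j) := by
  set B : ℕ → Set α := fun j =>
    {w | ENNReal.ofReal (δ ^ j * N j) ≤ ∑ k ∈ Finset.range (N j), t (F^[k] w)} with hB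
  have hδ0 : 0 < δ := zero_lt_one.trans hδ
  have hBle : ∀ j, μ (B j) ≤ ENNReal.ofReal ((1 / δ) ^ j) * ∫⁻ w, t w ∂μ := by
    intro j
    have hNj : (0 : ℝ) < N j := by exact_mod_cast hN j
    have hmeas : Measurable fun w => ∑ k ∈ Finset.range (N j), t (F^[k] w) :=
      Finset.measurable_sum _ fun k _ => ht.comp (hF.measurable.iterate k)
    -- Markov's inequality: the mean `N j * ∫ t` against the threshold `δ ^ j * N j` leaves `δ⁻ʲ ∫
    -- t`, summable whatever `N` is. No ergodic theorem is needed.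
    have h1 := meas_ge_le_lintegral_div (μ := μ) hmeas.aemeasurable
      (ε := ENNReal.ofReal (δ ^ j * N j)) (by simp; positivity) ENNReal.ofReal_ne_top
    refine h1.trans (le_of_eq ?_)
    have h2 : ∫⁻ w, ∑ k ∈ Finset.range (N j), t (F^[k] w) ∂μ = N j * ∫⁻ w, t w ∂μ := by
      rw [lintegral_finsetSum (f := fun k w => t (F^[k] w)) _
        fun k _ => ht.comp (hF.measurable.iterate k)]
      rw [Finset.sum_congr rfl (g := fun _ => ∫⁻ w, t w ∂μ)
        (fun k _ => (hF.iterate k).lintegral_comp ht)]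
      simp
    rw [h2, ENNReal.div_eq_inv_mul, ← ENNReal.ofReal_inv_of_pos (by positivity), ← mul_assoc,
      ← ENNReal.ofReal_natCast, ← ENNReal.ofReal_mul (by positivity)]
    congr 2
    rw [one_div, inv_pow]
    field_simp
  have hfin : ∑' j, μ (B j) ≠ ∞ := by
    refine ne_top_of_le_ne_top ?_ (ENNReal.tsum_le_tsum hBle)
    rw [ENNReal.tsum_mul_right]
    refine ENNReal.mul_ne_top (Summable.tsum_ofReal_ne_top ?_) hint
    exact summable_geometric_of_lt_one (by positivity) ((div_lt_one hδ0).2 hδ)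
  filter_upwards [ae_eventually_notMem hfin] with w hw
  filter_upwards [hw] with j hj
  exact not_le.1 hj

variable [IsProbabilityMeasure μ]

/-- Covariances of the centered observables along the orbit depend on the time gap only. -/
lemma integral_centered_mul_le (hF : MeasurePreserving F μ μ) {f : α → ℝ} (hf : Measurable f)
    (hf0 : ∀ w, 0 ≤ f w) (hf1 : ∀ w, f w ≤ 1) {K : ℕ} {D : ℝ} (hD : 0 ≤ D)
    (hdec : ∀ n, K ≤ n → (∫ w, f w * f (F^[n] w) ∂μ) - (∫ w, f w ∂μ) ^ 2 ≤ D) (i n : ℕ) :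
    ∫ w, (f (F^[i] w) - ∫ v, f v ∂μ) * (f (F^[i + n] w) - ∫ v, f v ∂μ) ∂μ
      ≤ (if n < K then ∫ w, f w ∂μ else 0) + D := by
  set m := ∫ w, f w ∂μ with hm
  have bdd : ∀ u : α → ℝ, Measurable u → (∀ w, 0 ≤ u w) → (∀ w, u w ≤ 1) →
      Integrable u μ := fun u hu hu0 hu1 => Integrable.of_bound hu.aestronglyMeasurable 1
    (Eventually.of_forall fun w => by rw [Real.norm_eq_abs, abs_of_nonneg (hu0 w)]; exact hu1 w)
  have hfn : Measurable fun w => f (F^[n] w) := hf.comp (hF.measurable.iterate n)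
  have h1 : ∫ w, (f (F^[i] w) - m) * (f (F^[i + n] w) - m) ∂μ
      = ∫ w, (f w - m) * (f (F^[n] w) - m) ∂μ := by
    rw [← integral_comp_iterate hF (f := fun w => (f w - m) * (f (F^[n] w) - m))
      ((hf.sub_const m).mul (hfn.sub_const m)) i]
    simp only [← Function.iterate_add_apply, add_comm i n]
  have hi0 := bdd f hf hf0 hf1
  have hi1 := bdd _ hfn (fun _ => hf0 _) (fun _ => hf1 _)
  have hi2 := bdd _ (hf.mul hfn) (fun w => mul_nonneg (hf0 _) (hf0 _))
    (fun w => mul_le_one₀ (hf1 _) (hf0 _) (hf1 _))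
  have h2 : ∫ w, (f w - m) * (f (F^[n] w) - m) ∂μ = (∫ w, f w * f (F^[n] w) ∂μ) - m ^ 2 := by
    have : ∀ w, (f w - m) * (f (F^[n] w) - m)
        = f w * f (F^[n] w) - m * f w - (m * f (F^[n] w) - m ^ 2) := fun w => by ring
    simp_rw [this]
    have hmf := hi0.const_mul m
    have hmfn := hi1.const_mul m
    have hsub := hi2.sub hmf
    have hsub2 := hmfn.sub (integrable_const (m ^ 2))
    simp only [Pi.sub_def, Pi.mul_def] at hsub hsub2 hi2
    rw [integral_sub hsub hsub2, integral_sub hi2 hmf,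
      integral_sub hmfn (integrable_const _), integral_const_mul, integral_const_mul,
      integral_comp_iterate hF hf n]
    simp only [integral_const, probReal_univ, one_smul]
    rw [← hm]
    ring
  rw [h1, h2]
  split_ifs with h
  -- For short gaps no decorrelation is available; `f ≤ 1` bounds the correlation by the mean.
  · have h3 : ∫ w, f w * f (F^[n] w) ∂μ ≤ m :=
      integral_mono hi2 hi0 fun w => mul_le_of_le_one_right (hf0 w) (hf1 _)
    nlinarith [sq_nonneg m]
  · rw [zero_add]; exact hdec n (not_lt.1 h)

/-- The variance is expanded into covariances. Pairs closer than `K` in time cost the mean each and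
number at most `2 * K` per row; every pair costs at most a further `D`. -/
lemma integral_sq_sum_centered_le (hF : MeasurePreserving F μ μ) {f : α → ℝ} (hf : Measurable f)
    (hf0 : ∀ w, 0 ≤ f w) (hf1 : ∀ w, f w ≤ 1) {K : ℕ} {D : ℝ} (hD : 0 ≤ D)
    (hdec : ∀ n, K ≤ n → (∫ w, f w * f (F^[n] w) ∂μ) - (∫ w, f w ∂μ) ^ 2 ≤ D) (N : ℕ) :
    Integrable (fun w => (∑ k ∈ Finset.range N, (f (F^[k] w) - ∫ v, f v ∂μ)) ^ 2) μ ∧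
    ∫ w, (∑ k ∈ Finset.range N, (f (F^[k] w) - ∫ v, f v ∂μ)) ^ 2 ∂μ
      ≤ N * (2 * K * (∫ w, f w ∂μ) + N * D) := by
  set m := ∫ w, f w ∂μ with hm
  have hm0 : 0 ≤ m := integral_nonneg hf0
  have hfk : ∀ k, Measurable fun w => f (F^[k] w) := fun k => hf.comp (hF.measurable.iterate k)
  have hij : ∀ i j, Integrable (fun w => (f (F^[i] w) - m) * (f (F^[j] w) - m)) μ := by
    intro i j
    refine Integrable.of_bound (((hfk i).sub_const m).mul
      ((hfk j).sub_const m)).aestronglyMeasurable ((1 + m) * (1 + m))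
      (Eventually.of_forall fun w => ?_)
    have h : ∀ v, |f v - m| ≤ 1 + m := fun v => by
      rw [abs_le]; constructor <;> linarith [hf0 v, hf1 v]
    rw [Real.norm_eq_abs, abs_mul]
    exact mul_le_mul (h _) (h _) (abs_nonneg _) (by linarith)
  have hexp : ∀ w, (∑ k ∈ Finset.range N, (f (F^[k] w) - m)) ^ 2
      = ∑ i ∈ Finset.range N, ∑ j ∈ Finset.range N, (f (F^[i] w) - m) * (f (F^[j] w) - m) :=
    fun w => by rw [sq, Finset.sum_mul_sum]
  simp_rw [hexp]
  refine ⟨integrable_finsetSum _ fun i _ => integrable_finsetSum _ fun j _ => hij i j, ?_⟩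
  rw [integral_finsetSum _ fun i _ => integrable_finsetSum _ fun j _ => hij i j]
  have hrow : ∀ i ∈ Finset.range N,
      ∫ w, ∑ j ∈ Finset.range N, (f (F^[i] w) - m) * (f (F^[j] w) - m) ∂μ
        ≤ 2 * K * m + N * D := by
    intro i _
    rw [integral_finsetSum _ fun j _ => hij i j]
    -- The window contains all `j` with `|i - j| < K`; the truncated subtraction only cuts it off at
    -- `0`.
    have hc : ∀ j ∈ Finset.range N, ∫ w, (f (F^[i] w) - m) * (f (F^[j] w) - m) ∂μ
        ≤ (if j ∈ Finset.Ico (i + 1 - K) (i + K) then m else 0) + D := by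
      intro j _
      rcases le_total i j with h | h
      · obtain ⟨n, rfl⟩ := Nat.exists_eq_add_of_le h
        refine (integral_centered_mul_le hF hf hf0 hf1 hD hdec i n).trans ?_
        gcongr
        split_ifs with h1 h2 h2
        · exact le_rfl
        · exact absurd (Finset.mem_Ico.2 ⟨by omega, by omega⟩) h2
        · exact hm0
        · exact le_rfl
      · obtain ⟨n, rfl⟩ := Nat.exists_eq_add_of_le h
        have := integral_centered_mul_le hF hf hf0 hf1 hD hdec j n
        simp_rw [mul_comm (f (F^[j + n] _) - m)]
        refine this.trans ?_
        gcongr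
        split_ifs with h1 h2 h2
        · exact le_rfl
        · exact absurd (Finset.mem_Ico.2 ⟨by omega, by omega⟩) h2
        · exact hm0
        · exact le_rfl
    refine (Finset.sum_le_sum hc).trans ?_
    rw [Finset.sum_add_distrib, Finset.sum_const, Finset.card_range, nsmul_eq_mul,
      ← Finset.sum_filter, Finset.sum_const, nsmul_eq_mul]
    gcongr
    have hsub : (Finset.range N).filter (fun j => j ∈ Finset.Ico (i + 1 - K) (i + K))
        ⊆ Finset.Ico (i + 1 - K) (i + K) := fun j hj => (Finset.mem_filter.1 hj).2
    have := Finset.card_le_card hsub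
    rw [Nat.card_Ico] at this
    exact_mod_cast (this.trans (by omega) : _ ≤ 2 * K)
  refine (Finset.sum_le_sum hrow).trans ?_
  rw [Finset.sum_const, Finset.card_range, nsmul_eq_mul]

/-- Chebyshev's inequality: the probability that `f` vanishes along an orbit of length `N`. -/
lemma measureReal_forall_eq_zero_le (hF : MeasurePreserving F μ μ) {f : α → ℝ}
    (hf : Measurable f) (hf0 : ∀ w, 0 ≤ f w) (hf1 : ∀ w, f w ≤ 1) {K : ℕ} {D : ℝ} (hD : 0 ≤ D)
    (hdec : ∀ n, K ≤ n → (∫ w, f w * f (F^[n] w) ∂μ) - (∫ w, f w ∂μ) ^ 2 ≤ D)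
    {m₀ : ℝ} (hm₀ : 0 < m₀) (hm : m₀ ≤ ∫ w, f w ∂μ) {N : ℕ} (hN : 0 < N) :
    μ.real {w | ∀ k < N, f (F^[k] w) = 0} ≤ 2 * K / (N * m₀) + D / m₀ ^ 2 := by
  obtain ⟨hi, hle⟩ := integral_sq_sum_centered_le hF hf hf0 hf1 hD hdec N
  set m := ∫ w, f w ∂μ with hmdef
  have hmpos : 0 < m := hm₀.trans_le hm
  have hNr : (0 : ℝ) < N := by exact_mod_cast hN
  have hmk := mul_meas_ge_le_integral_of_nonneg (μ := μ)
    (f := fun w => (∑ k ∈ Finset.range N, (f (F^[k] w) - m)) ^ 2)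
    (Eventually.of_forall fun w => sq_nonneg _) hi ((N * m) ^ 2)
  -- On this event the centered sum equals `-(N * m)`, a deviation as large as the mean itself.
  have hsub : {w | ∀ k < N, f (F^[k] w) = 0}
      ⊆ {w | (N * m) ^ 2 ≤ (∑ k ∈ Finset.range N, (f (F^[k] w) - m)) ^ 2} := by
    intro w hw
    have : ∑ k ∈ Finset.range N, (f (F^[k] w) - m) = -(N * m) := by
      rw [Finset.sum_congr rfl (g := fun _ => -m)
        (fun k hk => by rw [hw k (Finset.mem_range.1 hk), zero_sub])]
      simp
    rw [mem_ofPred_eq, this, neg_sq]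
  have h1 : (N * m) ^ 2 * μ.real {w | ∀ k < N, f (F^[k] w) = 0} ≤ N * (2 * K * m + N * D) :=
    (mul_le_mul_of_nonneg_left (measureReal_mono hsub) (sq_nonneg _)).trans (hmk.trans hle)
  have h2 : μ.real {w | ∀ k < N, f (F^[k] w) = 0} ≤ 2 * K / (N * m) + D / m ^ 2 := by
    have : 2 * K / (N * m) + D / m ^ 2 = N * (2 * K * m + N * D) / (N * m) ^ 2 := by
      field_simp
    rw [this, le_div_iff₀ (by positivity), mul_comm]
    exact h1
  refine h2.trans ?_
  gcongr

/-- The term is `(A * ρ ^ j) ^ j`, with base eventually at most `1 / 2`. -/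
lemma summable_pow_mul_pow_sq {A ρ : ℝ} (hA : 0 ≤ A) (hρ0 : 0 ≤ ρ) (hρ1 : ρ < 1) :
    Summable fun j : ℕ => A ^ j * ρ ^ (j ^ 2) := by
  have hlim : Tendsto (fun j : ℕ => A * ρ ^ j) atTop (𝓝 0) := by
    simpa using (tendsto_pow_atTop_nhds_zero_of_lt_one hρ0 hρ1).const_mul A
  have hev : ∀ᶠ j : ℕ in atTop, A * ρ ^ j ≤ 1 / 2 := hlim.eventually_le_const (by norm_num)
  refine Summable.of_norm_bounded_eventually_nat (g := fun j : ℕ => (1 / 2 : ℝ) ^ j)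
    (summable_geometric_of_lt_one (by norm_num) (by norm_num)) (hev.mono fun j hj => ?_)
  rw [Real.norm_of_nonneg (by positivity), sq, pow_mul, ← mul_pow]
  exact pow_le_pow_left₀ (by positivity) hj j

/-- If the observables `f j` decorrelate exponentially, up to a factor `c₁ 2 ^ j`, then almost
every orbit meets the support of `f j` before time `γ ^ j`, provided that `∫ f j ≥ c₂ β ^ j` with
`1 < β γ`. -/
lemma ae_eventually_exists_pos (hF : MeasurePreserving F μ μ) {f : ℕ → α → ℝ}
    (hf : ∀ j, Measurable (f j)) (hf0 : ∀ j w, 0 ≤ f j w) (hf1 : ∀ j w, f j w ≤ 1)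
    {c₁ c₂ ρ β γ : ℝ} (hc₁ : 0 ≤ c₁) (hc₂ : 0 < c₂) (hρ0 : 0 ≤ ρ) (hρ1 : ρ < 1) (hβ : 0 < β)
    (hγ : 0 < γ) (hβγ : 1 < β * γ)
    (hdec : ∀ j n, (∫ w, f j w * f j (F^[n] w) ∂μ) - (∫ w, f j w ∂μ) ^ 2
      ≤ c₁ * 2 ^ j * ρ ^ (n / 2))
    (hm : ∀ᶠ j in atTop, c₂ * β ^ j ≤ ∫ w, f j w ∂μ)
    (N : ℕ → ℕ) (hN : ∀ j, γ ^ j ≤ N j) :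
    ∀ᵐ w ∂μ, ∀ᶠ j in atTop, ∃ k < N j, 0 < f j (F^[k] w) := by
  have hbound : ∀ᶠ j in atTop, μ.real {w | ∀ k < N j, f j (F^[k] w) = 0}
      ≤ 4 / c₂ * ((j : ℝ) ^ 2 * (1 / (β * γ)) ^ j)
        + c₁ / c₂ ^ 2 * ((2 / β ^ 2) ^ j * ρ ^ (j ^ 2)) := by
    filter_upwards [hm] with j hj
    have hNj : (0 : ℝ) < N j := lt_of_lt_of_le (by positivity) (hN j)
    -- A gap of `2 * j ^ 2` is only polynomial, hence harmless against `(β * γ) ^ j`, while `ρ ^ (j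
    -- ^ 2)` beats the exponential factors `2 ^ j` and `β ^ (-2 * j)`.
    have h1 := measureReal_forall_eq_zero_le hF (hf j) (hf0 j) (hf1 j) (K := 2 * j ^ 2)
      (D := c₁ * 2 ^ j * ρ ^ (j ^ 2)) (by positivity)
      (fun n hn => (hdec j n).trans
        (mul_le_mul_of_nonneg_left (pow_le_pow_of_le_one hρ0 hρ1.le (by omega)) (by positivity)))
      (m₀ := c₂ * β ^ j) (by positivity) hj (by exact_mod_cast hNj)
    refine h1.trans (add_le_add ?_ (le_of_eq ?_))
    · calc 2 * ((2 * j ^ 2 : ℕ) : ℝ) / (N j * (c₂ * β ^ j))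
          ≤ 2 * ((2 * j ^ 2 : ℕ) : ℝ) / (γ ^ j * (c₂ * β ^ j)) := by
            gcongr; exact hN j
        _ = _ := by
            push_cast
            rw [one_div, inv_pow, mul_pow]
            have h1 : β ^ j ≠ 0 := by positivity
            have h2 : γ ^ j ≠ 0 := by positivity
            generalize β ^ j = b at h1
            generalize γ ^ j = g at h2
            field_simp
            ring
    · rw [div_pow, ← pow_mul, mul_comm 2 j, pow_mul]
      have h2 : β ^ j ≠ 0 := by positivity
      generalize β ^ j = b at h2
      generalize (2 : ℝ) ^ j = e
      generalize ρ ^ j ^ 2 = r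
      field_simp
  have hsum : Summable fun j : ℕ => 4 / c₂ * ((j : ℝ) ^ 2 * (1 / (β * γ)) ^ j)
        + c₁ / c₂ ^ 2 * ((2 / β ^ 2) ^ j * ρ ^ (j ^ 2)) := by
    have hr : ‖1 / (β * γ)‖ < 1 := by
      rw [Real.norm_of_nonneg (by positivity)]
      exact (div_lt_one (by positivity)).2 hβγ
    have s1 : Summable fun j : ℕ => (j : ℝ) ^ 2 * (1 / (β * γ)) ^ j :=
      summable_pow_mul_geometric_of_norm_lt_one 2 hr
    have s2 : Summable fun j : ℕ => (2 / β ^ 2) ^ j * ρ ^ (j ^ 2) :=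
      summable_pow_mul_pow_sq (by positivity) hρ0 hρ1
    exact (s1.mul_left (4 / c₂)).add (s2.mul_left (c₁ / c₂ ^ 2))
  have hs : Summable fun j => μ.real {w | ∀ k < N j, f j (F^[k] w) = 0} :=
    Summable.of_norm_bounded_eventually_nat hsum (hbound.mono fun j hj => by
      rwa [Real.norm_of_nonneg measureReal_nonneg])
  have hfin : ∑' j, μ {w | ∀ k < N j, f j (F^[k] w) = 0} ≠ ∞ := by
    have := hs.tsum_ofReal_ne_top
    simpa [measureReal_def] using this
  filter_upwards [ae_eventually_notMem hfin] with w hw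
  filter_upwards [hw] with j hj
  simp only [not_forall] at hj
  obtain ⟨k, hk, h⟩ := hj
  exact ⟨k, hk, lt_of_le_of_ne (hf0 _ _) (Ne.symm h)⟩

/-- Almost every orbit avoids the sets `A j` up to time `γ ^ j` if `μ (A j) ≤ c β ^ j` with
`β γ < 1`. -/
lemma ae_eventually_forall_notMem (hF : MeasurePreserving F μ μ) {A : ℕ → Set α}
    (hA : ∀ j, MeasurableSet (A j)) {c β γ : ℝ} (hβ : 0 ≤ β) (hγ : 1 ≤ γ)
    (hβγ : β * γ < 1) (hm : ∀ᶠ j in atTop, μ.real (A j) ≤ c * β ^ j) :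
    ∀ᵐ w ∂μ, ∀ᶠ j in atTop, ∀ k : ℕ, (k : ℝ) ≤ γ ^ j → F^[k] w ∉ A j := by
  set B : ℕ → Set α := fun j => {w | ∃ k : ℕ, (k : ℝ) ≤ γ ^ j ∧ F^[k] w ∈ A j} with hB
  have hBle : ∀ᶠ j in atTop, μ.real (B j) ≤ 2 * c * (β * γ) ^ j := by
    filter_upwards [hm] with j hj
    have hγj : 1 ≤ γ ^ j := one_le_pow₀ hγ
    have hsub : B j ⊆ ⋃ k ∈ Finset.range (⌊γ ^ j⌋₊ + 1), F^[k] ⁻¹' A j := by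
      rintro w ⟨k, hk, hw⟩
      simp only [mem_iUnion, Finset.mem_range]
      exact ⟨k, Nat.lt_succ_of_le (Nat.le_floor hk), hw⟩
    calc μ.real (B j) ≤ μ.real (⋃ k ∈ Finset.range (⌊γ ^ j⌋₊ + 1), F^[k] ⁻¹' A j) :=
          measureReal_mono hsub (measure_ne_top _ _)
      _ ≤ ∑ k ∈ Finset.range (⌊γ ^ j⌋₊ + 1), μ.real (F^[k] ⁻¹' A j) :=
          measureReal_biUnion_finset_le _ _
      _ = ∑ k ∈ Finset.range (⌊γ ^ j⌋₊ + 1), μ.real (A j) := by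
          refine Finset.sum_congr rfl fun k _ => ?_
          rw [measureReal_def, (hF.iterate k).measure_preimage (hA j).nullMeasurableSet,
            measureReal_def]
      _ = (⌊γ ^ j⌋₊ + 1 : ℝ) * μ.real (A j) := by simp
      _ ≤ (2 * γ ^ j) * (c * β ^ j) := by
          have := Nat.floor_le (zero_le_one.trans hγj)
          gcongr
          linarith
      _ = _ := by rw [mul_pow]; ring
  have hs : Summable fun j => μ.real (B j) :=
    Summable.of_norm_bounded_eventually_nat
      ((summable_geometric_of_lt_one (by positivity) hβγ).mul_left (2 * c))
      (hBle.mono fun j hj => by rwa [Real.norm_of_nonneg measureReal_nonneg])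
  have hfin : ∑' j, μ (B j) ≠ ∞ := by
    have := hs.tsum_ofReal_ne_top
    simpa [measureReal_def] using this
  filter_upwards [ae_eventually_notMem hfin] with w hw
  filter_upwards [hw] with j hj k hk hmem
  exact hj ⟨k, hk, hmem⟩

end Discrete

end LorenzFlow

/-! ### The section and its return times -/

namespace LorenzFlow

/-- A first hitting time of a closed set, among times bounded below, is measurable. -/
lemma measurable_iInf_ofReal {Y : Type*} [TopologicalSpace Y] [MeasurableSpace Y] [BorelSpace Y]
    {l : ℝ} {C : Set (ℝ × Y)} (hC : IsClosed C) :
    Measurable fun y : Y => ⨅ (t : ℝ) (_ : l ≤ t ∧ (t, y) ∈ C), ENNReal.ofReal t := by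
  refine measurable_of_Iio fun b => ?_
  have heq : (fun y : Y => ⨅ (t : ℝ) (_ : l ≤ t ∧ (t, y) ∈ C), ENNReal.ofReal t) ⁻¹' Iio b
      = ⋃ (q : ℚ) (_ : ENNReal.ofReal q < b), {y | ∃ t ∈ Icc l (q : ℝ), (t, y) ∈ C} := by
    ext y
    simp only [mem_preimage, mem_Iio, iInf_lt_iff, mem_iUnion, exists_prop]
    constructor
    · rintro ⟨t, ⟨hl, ht⟩, htb⟩
      obtain ⟨q, hq0, h1, h2⟩ := ENNReal.lt_iff_exists_rat_btwn.1 htb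
      refine ⟨q, by simpa [ENNReal.ofReal] using h2, t, ⟨hl, ?_⟩, ht⟩
      have h3 : ENNReal.ofReal t < ENNReal.ofReal q := by simpa [ENNReal.ofReal] using h1
      exact ((ENNReal.ofReal_lt_ofReal_iff').1 h3).1.le
    · rintro ⟨q, hq, t, ⟨hl, htq⟩, ht⟩
      exact ⟨t, ⟨hl, ht⟩, (ENNReal.ofReal_le_ofReal htq).trans_lt hq⟩
  rw [heq]
  refine MeasurableSet.iUnion fun q => MeasurableSet.iUnion fun _ => IsClosed.measurableSet ?_
  have : {y | ∃ t ∈ Icc l (q : ℝ), (t, y) ∈ C}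
      = Prod.snd '' ((fun p : Icc l (q : ℝ) × Y => ((p.1 : ℝ), p.2)) ⁻¹' C) := by
    ext y
    simp
  rw [this]
  -- Bounded times form a compact interval, so projecting along it preserves closedness.
  exact isClosedMap_snd_of_compactSpace _ (hC.preimage (by fun_prop))

lemma measurable_hittingTime (X : Flow ℝ E3) (r : ℝ) (x₀ : E3) :
    Measurable fun x => hittingTime X r x x₀ := by
  have hC : IsClosed {p : ℝ × E3 | X p.1 p.2 ∈ Metric.closedBall x₀ r} :=
    Metric.isClosed_closedBall.preimage (by fun_prop)
  exact measurable_iInf_ofReal (l := 0) hC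

lemma isometry_toPlane : Isometry toPlane :=
  Isometry.of_dist_eq fun _ _ => rfl

lemma range_toPlane : range toPlane = planeSquare := by
  ext p
  constructor
  · rintro ⟨w, rfl⟩; exact ⟨w.1.2, w.2.2⟩
  · rintro ⟨h1, h2⟩; exact ⟨(⟨p.1, h1⟩, ⟨p.2, h2⟩), rfl⟩

lemma toPlane_mem (w : Square) : toPlane w ∈ planeSquare := range_toPlane ▸ mem_range_self w

variable {X : Flow ℝ E3} {σ : ℝ × ℝ → E3}

lemma mem_image_section_iff {p : E3} : p ∈ σ '' planeSquare ↔ ∃ w : Square, σ (toPlane w) = p := by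
  rw [← range_toPlane, ← range_comp, mem_range]; rfl

lemma IsTransversalSection.continuous (hσ : IsTransversalSection X σ) :
    Continuous fun w : Square => σ (toPlane w) := by
  rw [continuous_iff_continuousAt]
  intro w
  exact (hσ.contDiffAt _ (toPlane_mem w)).continuousAt.comp isometry_toPlane.continuous.continuousAt

lemma IsTransversalSection.injective (hσ : IsTransversalSection X σ) :
    Function.Injective fun w : Square => σ (toPlane w) := fun v w h =>
  isometry_toPlane.injective (hσ.injOn (toPlane_mem v) (toPlane_mem w) h)

lemma IsTransversalSection.isClosed_image (hσ : IsTransversalSection X σ) :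
    IsClosed (σ '' planeSquare) := by
  rw [← range_toPlane, ← range_comp]
  exact (isCompact_range hσ.continuous).isClosed

lemma IsTransversalSection.contDiffAt_sectionFlow (hσ : IsTransversalSection X σ)
    (hX : IsC1Flow X) {w : ℝ × ℝ} (hw : w ∈ planeSquare) (t : ℝ) :
    ContDiffAt ℝ 1 (sectionFlow X σ) (w, t) := by
  have h1 : ContDiffAt ℝ 1 (fun q : (ℝ × ℝ) × ℝ => (q.2, σ q.1)) (w, t) :=
    contDiffAt_snd.prodMk ((hσ.contDiffAt w hw).comp (w, t) contDiffAt_fst)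
  exact (ContDiff.contDiffAt hX).comp (w, t) h1

/-- The flow map from the section is injective near time zero. -/
lemma IsTransversalSection.exists_localInverse (hσ : IsTransversalSection X σ)
    (hX : IsC1Flow X) {w : ℝ × ℝ} (hw : w ∈ planeSquare) :
    ∃ g : E3 → (ℝ × ℝ) × ℝ, ∀ᶠ q in 𝓝 (w, (0 : ℝ)), g (sectionFlow X σ q) = q := by
  have hs := (hσ.contDiffAt_sectionFlow hX hw 0).hasStrictFDerivAt one_ne_zero
  set Φ' := fderiv ℝ (sectionFlow X σ) (w, (0 : ℝ)) with hΦ'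
  have h1 : ∀ u : ℝ × ℝ, Φ' (u, 0) = fderiv ℝ σ w u := by
    have hc := hs.hasFDerivAt.comp w (hasFDerivAt_prodMk_left (𝕜 := ℝ) w (0 : ℝ))
    have he : sectionFlow X σ ∘ (fun v => (v, (0 : ℝ))) = σ := by
      ext1 v; simp [sectionFlow]
    rw [he] at hc
    intro u
    rw [hc.fderiv]
    simp
  have h2 : Φ' (0, 1) = velocity X (σ w) := by
    have hc := hs.hasFDerivAt.comp (0 : ℝ) (hasFDerivAt_prodMk_right (𝕜 := ℝ) w (0 : ℝ))
    have he : sectionFlow X σ ∘ (fun t => (w, t)) = fun t => X t (σ w) := by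
      ext1 v; simp [sectionFlow]
    rw [he] at hc
    rw [velocity, hc.hasDerivAt.deriv]
    simp
  -- At time zero, injectivity of the derivative is transversality. Both spaces have dimension
  -- three, so the inverse function theorem applies.
  have hinj : Function.Injective Φ' := by
    have : (Φ' : (ℝ × ℝ) × ℝ → E3)
        = fun q => fderiv ℝ σ w q.1 + q.2 • velocity X (σ w) := by
      ext1 q
      have hq : q = (q.1, 0) + q.2 • ((0 : ℝ × ℝ), (1 : ℝ)) := by
        ext <;> simp
      conv_lhs => rw [hq]
      rw [map_add, map_smul, h1, h2]
    rw [this]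
    exact hσ.transversal w hw
  have hdim : Module.finrank ℝ ((ℝ × ℝ) × ℝ) = Module.finrank ℝ E3 := by simp
  let e : ((ℝ × ℝ) × ℝ) ≃L[ℝ] E3 :=
    (LinearEquiv.ofInjectiveOfFinrankEq (Φ' : ((ℝ × ℝ) × ℝ) →ₗ[ℝ] E3) hinj
      hdim).toContinuousLinearEquiv
  have he : (e : ((ℝ × ℝ) × ℝ) →L[ℝ] E3) = Φ' := by
    ext q <;> rfl
  rw [← he] at hs
  exact ⟨_, hs.eventually_left_inverse⟩

/-- Return times to a transversal section are bounded below. -/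
lemma IsTransversalSection.exists_pos_le_returns (hσ : IsTransversalSection X σ)
    (hX : IsC1Flow X) : ∃ c : ℝ, 0 < c ∧ ∀ (v w : Square) (s : ℝ), 0 < s →
      X s (σ (toPlane w)) = σ (toPlane v) → c ≤ s := by
  -- Otherwise there are returns in times tending to `0`. By compactness and injectivity of `σ`, a
  -- subsequence has both endpoints converging to one point `a`, and there `(w, s)` and `(v, 0)`
  -- have the same image, contradicting local injectivity.
  by_contra! hcon
  choose v w s hs0 hs hlt using fun n : ℕ => hcon (1 / (n + 1)) (by positivity)
  obtain ⟨⟨a, b⟩, -, φ, hφ, hlim⟩ := (isCompact_univ (X := Square × Square)).tendsto_subseq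
    (x := fun n => (v n, w n)) (fun _ => mem_univ _)
  have hva : Tendsto (fun n => v (φ n)) atTop (𝓝 a) := (continuous_fst.tendsto _).comp hlim
  have hwb : Tendsto (fun n => w (φ n)) atTop (𝓝 b) := (continuous_snd.tendsto _).comp hlim
  have hs' : Tendsto (fun n => s (φ n)) atTop (𝓝 0) := by
    have : Tendsto s atTop (𝓝 0) := tendsto_of_tendsto_of_tendsto_of_le_of_le
      tendsto_const_nhds tendsto_one_div_add_atTop_nhds_zero_nat
      (fun n => (hs0 n).le) (fun n => (hlt n).le)
    exact this.comp hφ.tendsto_atTop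
  have hab : a = b := by
    have h1 : Tendsto (fun n => X (s (φ n)) (σ (toPlane (w (φ n))))) atTop
        (𝓝 (X 0 (σ (toPlane b)))) := by
      have hc : Continuous fun p : ℝ × Square => X p.1 (σ (toPlane p.2)) :=
        X.continuous continuous_fst (hσ.continuous.comp continuous_snd)
      exact (hc.tendsto (0, b)).comp (hs'.prodMk_nhds hwb)
    have h2 : Tendsto (fun n => σ (toPlane (v (φ n)))) atTop (𝓝 (σ (toPlane a))) :=
      (hσ.continuous.tendsto a).comp hva
    have h3 := tendsto_nhds_unique (h2.congr fun n => (hs (φ n)).symm) h1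
    rw [Flow.map_zero_apply] at h3
    exact hσ.injective h3
  subst hab
  obtain ⟨g, hg⟩ := hσ.exists_localInverse hX (toPlane_mem a)
  have ht := isometry_toPlane.continuous.tendsto a
  have e1 := ((ht.comp hwb).prodMk_nhds hs').eventually hg
  have e2 := ((ht.comp hva).prodMk_nhds (tendsto_const_nhds (x := (0 : ℝ)))).eventually hg
  obtain ⟨n, h1, h2⟩ := (e1.and e2).exists
  simp only [sectionFlow, Function.comp_apply, Flow.map_zero_apply, hs] at h1 h2
  have := h1.symm.trans h2
  exact (hs0 (φ n)).ne' (congrArg Prod.snd this)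

lemma le_returnTime {c : ℝ} (hc : ∀ (v w : Square) (s : ℝ), 0 < s →
      X s (σ (toPlane w)) = σ (toPlane v) → c ≤ s) (w : Square) :
    ENNReal.ofReal c ≤ returnTime X σ (σ (toPlane w)) := by
  refine le_iInf₂ fun t ht => ENNReal.ofReal_le_ofReal ?_
  obtain ⟨v, hv⟩ := mem_image_section_iff.1 ht.2
  exact hc v w t ht.1 hv.symm

lemma returnTime_le {p : E3} {v : Square} {s : ℝ} (hs : 0 < s) (h : X s p = σ (toPlane v)) :
    returnTime X σ p ≤ ENNReal.ofReal s :=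
  iInf₂_le s ⟨hs, h ▸ mem_image_of_mem σ (toPlane_mem v)⟩

/-- The condition `0 < t` is not closed, but the uniform lower bound on returns replaces it by `c ≤
t`. -/
lemma IsTransversalSection.measurable_returnTime (hσ : IsTransversalSection X σ)
    (hX : IsC1Flow X) : Measurable fun w : Square => returnTime X σ (σ (toPlane w)) := by
  obtain ⟨c, hc0, hc⟩ := hσ.exists_pos_le_returns hX
  have hC : IsClosed {p : ℝ × Square | X p.1 (σ (toPlane p.2)) ∈ σ '' planeSquare} :=
    hσ.isClosed_image.preimage
      (X.continuous continuous_fst (hσ.continuous.comp continuous_snd))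
  convert measurable_iInf_ofReal (l := c) hC using 2 with w
  unfold returnTime
  refine iInf_congr fun t => iInf_congr_Prop ⟨fun h => ⟨?_, h.2⟩,
    fun h => ⟨hc0.trans_le h.1, h.2⟩⟩ fun _ => rfl
  obtain ⟨v, hv⟩ := mem_image_section_iff.1 h.2
  exact hc v w t h.1 hv.symm

/-- Near a regular point the flow box has Lipschitz inverse. -/
lemma IsRegularPoint.exists_flowBox {x₀ : E3} (hx₀ : IsRegularPoint X σ x₀) :
    ∃ (w₀ : Square) (t₀ : ℝ), 0 ≤ t₀ ∧ X t₀ (σ (toPlane w₀)) = x₀ ∧ ∃ C r₀ : ℝ, 0 < C ∧ 0 < r₀ ∧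
      ∀ (w : Square) (t : ℝ), 0 ≤ t → ∀ r < r₀, X t (σ (toPlane w)) ∈ Metric.closedBall x₀ r →
        ∃ (v : Square) (u : ℝ), X u (σ (toPlane v)) = X t (σ (toPlane w)) ∧
          v ∈ Metric.closedBall w₀ (C * r) ∧ |u - t₀| ≤ C * r := by
  obtain ⟨p₀, hp₀, t₀, ht₀, hx, U, hU, hUsub, himg, ψ, hψ, hinv⟩ := hx₀
  obtain ⟨w₀, rfl⟩ : p₀ ∈ range toPlane := range_toPlane ▸ hp₀
  have hmem : (toPlane w₀, t₀) ∈ U :=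
    mem_of_mem_nhdsWithin (show _ ∈ planeSquare ×ˢ univ from ⟨hp₀, mem_univ _⟩) hU
  have hψ0 : ψ x₀ = (toPlane w₀, t₀) := by
    rw [← hinv _ hmem, sectionFlow, hx]
  refine ⟨w₀, t₀, ht₀, hx, ?_⟩
  obtain ⟨K, s, hs, hLip⟩ := hψ.exists_lipschitzOnWith
  obtain ⟨ε, hε, hball⟩ := Metric.mem_nhds_iff.1 hs
  obtain ⟨V, hV, hVsub⟩ := mem_nhdsWithin_iff_exists_mem_nhds_inter.1 himg
  obtain ⟨δ, hδ, hballV⟩ := Metric.mem_nhds_iff.1 hV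
  refine ⟨K + 1, min ε δ, by positivity, lt_min hε hδ, fun w t ht r hr hmemb => ?_⟩
  have hd : dist (X t (σ (toPlane w))) x₀ ≤ r := hmemb
  have hVmem : X t (σ (toPlane w)) ∈ V ∩ orbitSpace X σ := ⟨hballV (show dist _ _ < δ from
    hd.trans_lt (hr.trans_le (min_le_right _ _))), ⟨_, toPlane_mem w, t, ht, rfl⟩⟩
  -- The chart coordinates `q` need not be `(w, t)`: an orbit may have met the section again before
  -- entering the box.
  obtain ⟨q, hq, hqe⟩ := hVsub hVmem
  obtain ⟨v, hv⟩ : q.1 ∈ range toPlane := range_toPlane ▸ (hUsub hq).1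
  have hl := hLip.dist_le_mul (X t (σ (toPlane w)))
    (hball (show dist _ _ < ε from hd.trans_lt (hr.trans_le (min_le_left _ _)))) x₀
    (mem_of_mem_nhds hs)
  rw [← hqe, hinv q hq, hψ0, hqe] at hl
  have hl2 : dist q (toPlane w₀, t₀) ≤ (K + 1) * r := by
    have hr0 : 0 ≤ r := dist_nonneg.trans hd
    have : (K : ℝ) * dist (X t (σ (toPlane w))) x₀ ≤ K * r := by gcongr
    nlinarith
  rw [Prod.dist_eq, ← hv, isometry_toPlane.dist_eq] at hl2
  refine ⟨v, q.2, ?_, (le_max_left _ _).trans hl2, (le_max_right _ _).trans hl2⟩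
  rw [hv]; exact hqe

/-- Points of the section near `w₀` flow into balls around `X^{t₀} (σ w₀)`. -/
lemma IsTransversalSection.exists_mem_closedBall (hσ : IsTransversalSection X σ)
    (hX : IsC1Flow X) (w₀ : Square) (t₀ : ℝ) : ∃ L r₁ : ℝ, 0 < L ∧ 0 < r₁ ∧
      ∀ r < r₁, ∀ v ∈ Metric.closedBall w₀ r, ∀ u : ℝ, |u - t₀| ≤ r →
        X u (σ (toPlane v)) ∈ Metric.closedBall (X t₀ (σ (toPlane w₀))) (L * r) := by
  obtain ⟨K, s, hs, hLip⟩ :=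
    (hσ.contDiffAt_sectionFlow hX (toPlane_mem w₀) t₀).exists_lipschitzOnWith
  obtain ⟨ε, hε, hball⟩ := Metric.mem_nhds_iff.1 hs
  refine ⟨K + 1, ε, by positivity, hε, fun r hr v hv u hu => ?_⟩
  have hd : dist (toPlane v, u) (toPlane w₀, t₀) ≤ r := by
    rw [Prod.dist_eq, isometry_toPlane.dist_eq]
    exact max_le hv hu
  have hr0 : 0 ≤ r := dist_nonneg.trans hd
  have hl := hLip.dist_le_mul (toPlane v, u) (hball (show dist _ _ < ε from hd.trans_lt hr))
    (toPlane w₀, t₀) (mem_of_mem_nhds hs)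
  refine (show dist _ _ ≤ _ from hl).trans ?_
  have : (K : ℝ) * dist (toPlane v, u) (toPlane w₀, t₀) ≤ K * r := by gcongr
  nlinarith

end LorenzFlow

/-! ### The suspension measure -/

namespace LorenzFlow

variable {X : Flow ℝ E3} {σ : ℝ × ℝ → E3} {F : Square → Square} {μ : Measure Square}

/-- All the points of the `F`-orbit of `w` return to the section, and `F` is the return map
there. -/
def FollowsReturns (X : Flow ℝ E3) (σ : ℝ × ℝ → E3) (F : Square → Square) (w : Square) : Prop :=
  ∀ k : ℕ, returnTime X σ (σ (toPlane (F^[k] w))) < ∞ ∧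
    X (returnTime X σ (σ (toPlane (F^[k] w)))).toReal (σ (toPlane (F^[k] w)))
      = σ (toPlane (F^[k + 1] w))

/-- The time of the `k`-th return to the section. -/
noncomputable def returnSum (X : Flow ℝ E3) (σ : ℝ × ℝ → E3) (F : Square → Square) (k : ℕ)
    (w : Square) : ℝ :=
  ∑ i ∈ Finset.range k, (returnTime X σ (σ (toPlane (F^[i] w)))).toReal

lemma IsFirstReturnMap.ae_followsReturns (hF : MeasurePreserving F μ μ)
    (hret : IsFirstReturnMap X σ F μ) : ∀ᵐ w ∂μ, FollowsReturns X σ F w := by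
  refine ae_all_iff.2 fun k => ?_
  have := (hF.iterate k).quasiMeasurePreserving.ae hret
  simpa only [Function.iterate_succ_apply'] using this

lemma FollowsReturns.flow_returnSum {w : Square} (hw : FollowsReturns X σ F w) (k : ℕ) :
    X (returnSum X σ F k w) (σ (toPlane w)) = σ (toPlane (F^[k] w)) := by
  induction k with
  | zero => simp [returnSum]
  | succ k ih =>
    rw [returnSum, Finset.sum_range_succ, add_comm, Flow.map_add, ← returnSum, ih]
    exact (hw k).2

lemma FollowsReturns.le_toReal {w : Square} (hw : FollowsReturns X σ F w) {c : ℝ}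
    (hle : ∀ w : Square, ENNReal.ofReal c ≤ returnTime X σ (σ (toPlane w))) (k : ℕ) :
    c ≤ (returnTime X σ (σ (toPlane (F^[k] w)))).toReal := by
  have h := hle (F^[k] w)
  exact (ENNReal.ofReal_le_iff_le_toReal (hw k).1.ne).1 h

lemma FollowsReturns.mul_le_returnSum {w : Square} (hw : FollowsReturns X σ F w) {c : ℝ}
    (hle : ∀ w : Square, ENNReal.ofReal c ≤ returnTime X σ (σ (toPlane w))) (k : ℕ) :
    c * k ≤ returnSum X σ F k w := by
  have := Finset.card_nsmul_le_sum (Finset.range k) _ c fun i _ => hw.le_toReal hle i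
  rw [Finset.card_range, nsmul_eq_mul] at this
  rw [mul_comm]; exact this

lemma returnSum_mono (w : Square) : Monotone fun k => returnSum X σ F k w :=
  monotone_nat_of_le_succ fun k => by
    simp only [returnSum, Finset.sum_range_succ]
    linarith [ENNReal.toReal_nonneg (a := returnTime X σ (σ (toPlane (F^[k] w))))]

/-- The forward visits to the section are exactly the successive returns. -/
lemma FollowsReturns.exists_eq_returnSum (hσ : IsTransversalSection X σ) {w v : Square}
    (hw : FollowsReturns X σ F w) {c : ℝ} (hc : 0 < c)
    (hle : ∀ w : Square, ENNReal.ofReal c ≤ returnTime X σ (σ (toPlane w)))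
    {a : ℝ} (ha : 0 ≤ a) (h : X a (σ (toPlane w)) = σ (toPlane v)) :
    ∃ k : ℕ, a = returnSum X σ F k w ∧ v = F^[k] w := by
  -- Returns cannot accumulate, since the `k`-th comes no earlier than `c * k`.
  have hex : ∃ k, a < returnSum X σ F (k + 1) w := by
    obtain ⟨k, hk⟩ := exists_nat_gt (a / c)
    refine ⟨k, lt_of_lt_of_le ?_ (hw.mul_le_returnSum hle (k + 1))⟩
    rw [div_lt_iff₀ hc] at hk
    push_cast
    linarith
  classical
  let k := Nat.find hex
  have hk : a < returnSum X σ F (k + 1) w := Nat.find_spec hex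
  have hk' : returnSum X σ F k w ≤ a := by
    rcases Nat.eq_zero_or_pos k with h0 | h0
    · rw [h0]; simpa [returnSum] using ha
    · have := Nat.find_min hex (m := k - 1) (by omega)
      rw [Nat.sub_add_cancel h0] at this
      exact not_lt.1 this
  have hXk : X (a - returnSum X σ F k w) (σ (toPlane (F^[k] w))) = σ (toPlane v) := by
    rw [← hw.flow_returnSum, ← Flow.map_add, sub_add_cancel, h]
  -- A visit strictly between consecutive returns would precede the first return of `F^[k] w`.
  have heq : a = returnSum X σ F k w := by
    by_contra hne
    have hlt : 0 < a - returnSum X σ F k w := sub_pos.2 (lt_of_le_of_ne hk' (Ne.symm hne))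
    have h1 := returnTime_le hlt hXk
    have h2 := (ENNReal.le_ofReal_iff_toReal_le (hw k).1.ne hlt.le).1 h1
    rw [returnSum, Finset.sum_range_succ, ← returnSum] at hk
    linarith
  refine ⟨k, heq, ?_⟩
  rw [heq, sub_self, Flow.map_zero_apply] at hXk
  exact hσ.injective hXk.symm

/-- The fundamental domain of the suspension is measurable. -/
lemma measurableSet_suspension (hσ : IsTransversalSection X σ) (hX : IsC1Flow X) :
    MeasurableSet {q : Square × ℝ | 0 ≤ q.2 ∧
      ENNReal.ofReal q.2 < returnTime X σ (σ (toPlane q.1))} :=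
  (measurableSet_le measurable_const measurable_snd).inter
    (measurableSet_lt (ENNReal.measurable_ofReal.comp measurable_snd)
      ((hσ.measurable_returnTime hX).comp measurable_fst))

lemma IsTransversalSection.continuous_flow (hσ : IsTransversalSection X σ) :
    Continuous fun q : Square × ℝ => X q.2 (σ (toPlane q.1)) :=
  X.continuous continuous_snd (hσ.continuous.comp continuous_fst)

/-- The flow measure as an integral of the times spent in a set before the first return. -/
lemma flowMeasure_apply (hσ : IsTransversalSection X σ) (hX : IsC1Flow X)
    [SFinite μ] {B : Set E3} (hB : MeasurableSet B) :
    flowMeasure X σ μ B = ∫⁻ w, volume {s : ℝ | (0 ≤ s ∧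
      ENNReal.ofReal s < returnTime X σ (σ (toPlane w))) ∧ X s (σ (toPlane w)) ∈ B} ∂μ := by
  rw [flowMeasure, Measure.map_apply hσ.continuous_flow.measurable hB,
    Measure.restrict_apply (hσ.continuous_flow.measurable hB), inter_comm,
    Measure.prod_apply ((measurableSet_suspension hσ hX).inter (hσ.continuous_flow.measurable hB))]
  rfl

/-- The flow measure is invariant under the flow. -/
lemma flowMeasure_preimage (hσ : IsTransversalSection X σ) (hX : IsC1Flow X)
    [IsProbabilityMeasure μ] (hF : MeasurePreserving F μ μ) (hret : IsFirstReturnMap X σ F μ)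
    {B : Set E3} (hB : MeasurableSet B) {a : ℝ} (ha : 0 ≤ a) :
    flowMeasure X σ μ (X a ⁻¹' B) = flowMeasure X σ μ B := by
  have hXa : Measurable (X a) := (X.continuous continuous_const continuous_id).measurable
  -- The time the orbit of `w` spends in `B` during `[p, q)`.
  set m : Square → ℝ → ℝ → ℝ≥0∞ := fun w p q =>
    volume (Ico p q ∩ {s | X s (σ (toPlane w)) ∈ B}) with hm
  have hBw : ∀ w : Square, MeasurableSet {s : ℝ | X s (σ (toPlane w)) ∈ B} := fun w =>
    (X.continuous continuous_id continuous_const).measurable hB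
  have hadd : ∀ w p q r, p ≤ q → q ≤ r → m w p r = m w p q + m w q r := by
    intro w p q r hpq hqr
    simp only [hm]
    rw [← Ico_union_Ico_eq_Ico hpq hqr, union_inter_distrib_right]
    refine measure_union ?_ (measurableSet_Ico.inter (hBw w))
    exact (Ico_disjoint_Ico_same).mono inter_subset_left inter_subset_left
  have hshift : ∀ (w : Square) (b t : ℝ),
      volume {s | (0 ≤ s ∧ s < t) ∧ X (b + s) (σ (toPlane w)) ∈ B} = m w b (b + t) := by
    intro w b t
    simp only [hm]
    rw [← measure_preimage_add volume b (Ico b (b + t) ∩ _)]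
    congr 1
    ext s
    simp
  have hmeas : Measurable fun w => m w 0 a := by
    have : MeasurableSet {q : Square × ℝ | q.2 ∈ Ico 0 a ∧ X q.2 (σ (toPlane q.1)) ∈ B} :=
      (measurable_snd measurableSet_Ico).inter (hσ.continuous_flow.measurable hB)
    exact measurable_measure_prodMk_left this
  have hfin : ∫⁻ w, m w 0 a ∂μ ≠ ∞ := by
    have : ∫⁻ w, m w 0 a ∂μ ≤ ∫⁻ w, ENNReal.ofReal a ∂μ := lintegral_mono fun w => by
      refine (measure_mono inter_subset_left).trans ?_
      simp
    refine ne_top_of_le_ne_top ?_ this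
    simp
  rw [flowMeasure_apply hσ hX hB, flowMeasure_apply hσ hX (hXa hB)]
  have e0 : ∀ᵐ w ∂μ, volume {s : ℝ | (0 ≤ s ∧ ENNReal.ofReal s < returnTime X σ (σ (toPlane w))) ∧
      X s (σ (toPlane w)) ∈ B} = m w 0 (returnTime X σ (σ (toPlane w))).toReal := by
    filter_upwards [hret] with w hw
    have := hshift w 0 (returnTime X σ (σ (toPlane w))).toReal
    simp only [zero_add] at this
    rw [← this]
    congr 1
    ext s
    refine and_congr_left fun _ => and_congr_right fun h0 => ?_
    exact ENNReal.ofReal_lt_iff_lt_toReal h0 hw.1.ne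
  have e1 : ∀ᵐ w ∂μ, volume {s : ℝ | (0 ≤ s ∧ ENNReal.ofReal s < returnTime X σ (σ (toPlane w))) ∧
      X s (σ (toPlane w)) ∈ X a ⁻¹' B} = m w a (a + (returnTime X σ (σ (toPlane w))).toReal) := by
    filter_upwards [hret] with w hw
    rw [← hshift]
    congr 1
    ext s
    refine and_congr (and_congr_right fun h0 => ENNReal.ofReal_lt_iff_lt_toReal h0 hw.1.ne) ?_
    rw [mem_preimage, ← Flow.map_add]
  rw [lintegral_congr_ae e0, lintegral_congr_ae e1]
  -- Both sides are the time spent in `B` during `[0, a + t)`, cut at `a` on the left and at the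
  -- first return `t` on the right. Integrating, invariance of `μ` makes the terms over `[0, a)`
  -- equal, and they cancel because they are at most `a`.
  have key : ∀ᵐ w ∂μ, m w 0 a + m w a (a + (returnTime X σ (σ (toPlane w))).toReal)
      = m (F w) 0 a + m w 0 (returnTime X σ (σ (toPlane w))).toReal := by
    filter_upwards [hret] with w hw
    set t := (returnTime X σ (σ (toPlane w))).toReal with ht
    have ht0 : 0 ≤ t := ENNReal.toReal_nonneg
    rw [← hadd w 0 a (a + t) ha (by linarith), add_comm a t,
      hadd w 0 t (t + a) ht0 (by linarith), add_comm]
    congr 1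
    rw [← hshift]
    have := hshift (F w) 0 a
    rw [zero_add] at this
    rw [← this]
    congr 1
    ext s
    refine and_congr_right fun _ => ?_
    rw [zero_add, add_comm t s, Flow.map_add, hw.2]
  have hsum := lintegral_congr_ae key
  have hmeasF : Measurable fun w => m (F w) 0 a := hmeas.comp hF.measurable
  rw [lintegral_add_left hmeas, lintegral_add_left hmeasF, hF.lintegral_comp hmeas] at hsum
  exact (ENNReal.add_right_inj hfin).1 hsum

/-- Flow boxes over small balls of the section have flow measure at least `r μ(B_r)`. -/
lemma exists_mul_measure_le_flowMeasure (hσ : IsTransversalSection X σ) (hX : IsC1Flow X)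
    [IsProbabilityMeasure μ] (hF : MeasurePreserving F μ μ) (hret : IsFirstReturnMap X σ F μ)
    (w₀ : Square) {t₀ : ℝ} (ht₀ : 0 ≤ t₀) : ∃ L r₁ : ℝ, 0 < L ∧ 0 < r₁ ∧
      ∀ r, 0 < r → r < r₁ → ENNReal.ofReal r * μ (Metric.closedBall w₀ r) ≤
        flowMeasure X σ μ (Metric.closedBall (X t₀ (σ (toPlane w₀))) (L * r)) := by
  obtain ⟨c, hc0, hc⟩ := hσ.exists_pos_le_returns hX
  obtain ⟨L, r₁, hL, hr₁, h⟩ := hσ.exists_mem_closedBall hX w₀ t₀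
  refine ⟨L, min r₁ c, hL, lt_min hr₁ hc0, fun r hr0 hr => ?_⟩
  set B := Metric.closedBall (X t₀ (σ (toPlane w₀))) (L * r) with hBdef
  have hB : MeasurableSet B := Metric.isClosed_closedBall.measurableSet
  have hXa : Measurable (X t₀) := (X.continuous continuous_const continuous_id).measurable
  -- Moving the ball back by `t₀` puts the box at the bottom of the fibres; `r < c` keeps it below
  -- the first return.
  rw [← flowMeasure_preimage hσ hX hF hret hB ht₀, flowMeasure_apply hσ hX (hXa hB)]
  rw [← setLIntegral_const]
  refine (setLIntegral_mono' Metric.isClosed_closedBall.measurableSet fun w hw => ?_).trans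
    (setLIntegral_le_lintegral _ _)
  have hvol : ENNReal.ofReal r = volume (Ico 0 r) := by simp
  rw [hvol]
  refine measure_mono fun s hs => ⟨⟨hs.1, ?_⟩, ?_⟩
  · refine lt_of_lt_of_le ?_ (le_returnTime hc w)
    exact (ENNReal.ofReal_lt_ofReal_iff hc0).2 (hs.2.trans (hr.trans_le (min_le_right _ _)))
  · rw [mem_preimage, ← Flow.map_add]
    refine h r (hr.trans_le (min_le_left _ _)) w hw _ ?_
    rw [add_sub_cancel_left, abs_of_nonneg hs.1]
    exact hs.2.le

/-- The flow measure of small balls around a regular point is at most of order `r μ(B_{Cr})`. -/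
lemma flowMeasure_closedBall_le (hσ : IsTransversalSection X σ) (hX : IsC1Flow X)
    [IsProbabilityMeasure μ] (hF : MeasurePreserving F μ μ) (hret : IsFirstReturnMap X σ F μ)
    {w₀ : Square} {t₀ : ℝ} (ht₀ : 0 ≤ t₀) {x₀ : E3} {C r₀ : ℝ} (hC : 0 < C) (hr₀ : 0 < r₀)
    (hbox : ∀ (w : Square) (t : ℝ), 0 ≤ t → ∀ r < r₀,
      X t (σ (toPlane w)) ∈ Metric.closedBall x₀ r →
        ∃ (v : Square) (u : ℝ), X u (σ (toPlane v)) = X t (σ (toPlane w)) ∧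
          v ∈ Metric.closedBall w₀ (C * r) ∧ |u - t₀| ≤ C * r) :
    ∃ r₂ : ℝ, 0 < r₂ ∧ ∀ r, 0 < r → r < r₂ →
      flowMeasure X σ μ (Metric.closedBall x₀ r)
        ≤ ENNReal.ofReal (2 * C * r) * μ (Metric.closedBall w₀ (C * r)) := by
  obtain ⟨c, hc0, hc⟩ := hσ.exists_pos_le_returns hX
  refine ⟨min r₀ (c / C), lt_min hr₀ (by positivity), fun r hr0 hr => ?_⟩
  have hrc : C * r < c := by
    have := hr.trans_le (min_le_right _ _)
    rw [lt_div_iff₀ hC] at this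
    linarith
  set B := Metric.closedBall x₀ r with hBdef
  set A := Metric.closedBall w₀ (C * r) with hAdef
  have hA : MeasurableSet A := Metric.isClosed_closedBall.measurableSet
  have hB : MeasurableSet B := Metric.isClosed_closedBall.measurableSet
  have hXa : Measurable (X t₀) := (X.continuous continuous_const continuous_id).measurable
  rw [← flowMeasure_preimage hσ hX hF hret hB ht₀, flowMeasure_apply hσ hX (hXa hB)]
  have hpt : ∀ᵐ w ∂μ, volume {s : ℝ | (0 ≤ s ∧
      ENNReal.ofReal s < returnTime X σ (σ (toPlane w))) ∧ X s (σ (toPlane w)) ∈ X t₀ ⁻¹' B}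
      ≤ A.indicator (fun _ => ENNReal.ofReal (C * r)) w
        + A.indicator (fun _ => ENNReal.ofReal (C * r)) (F w) := by
    filter_upwards [hret.ae_followsReturns hF] with w hw
    set t := (returnTime X σ (σ (toPlane w))).toReal with ht
    -- The flow box yields a visit to the section within time `C * r < c` of `s`. By the separation
    -- of returns it is the start `w` or the next return `F w`; earlier or later visits are
    -- excluded. The two alternatives explain the factor `2 * C`.
    have hsub : {s : ℝ | (0 ≤ s ∧
        ENNReal.ofReal s < returnTime X σ (σ (toPlane w))) ∧ X s (σ (toPlane w)) ∈ X t₀ ⁻¹' B}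
        ⊆ {s | w ∈ A ∧ s ∈ Icc 0 (C * r)} ∪ {s | F w ∈ A ∧ s ∈ Icc (t - C * r) t} := by
      rintro s ⟨⟨hs0, hst⟩, hsB⟩
      have hst' : s < t := (ENNReal.ofReal_lt_iff_lt_toReal hs0 (hw 0).1.ne).1 hst
      rw [mem_preimage, ← Flow.map_add] at hsB
      obtain ⟨v, u, hvu, hv, hu⟩ := hbox w (t₀ + s) (by linarith) r
        (hr.trans_le (min_le_left _ _)) hsB
      rw [abs_le] at hu
      have ha : X (t₀ + s - u) (σ (toPlane w)) = σ (toPlane v) := by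
        rw [sub_eq_neg_add, Flow.map_add, ← hvu, ← Flow.map_add, neg_add_cancel,
          Flow.map_zero_apply]
      rcases le_or_gt 0 (t₀ + s - u) with h0 | h0
      · obtain ⟨k, hk, hvk⟩ := hw.exists_eq_returnSum hσ hc0 (le_returnTime hc) h0 ha
        rcases k with _ | k
        · left
          refine ⟨by rw [hvk] at hv; exact hv, hs0, ?_⟩
          simp [returnSum] at hk
          linarith
        · rcases k with _ | k
          · right
            refine ⟨by rw [hvk] at hv; exact hv, ?_, hst'.le⟩
            simp [returnSum] at hk
            linarith
          · exfalso
            have h2 := returnSum_mono (X := X) (σ := σ) (F := F) w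
              (show 2 ≤ k + 1 + 1 by omega)
            have h3 : returnSum X σ F 2 w
                = t + (returnTime X σ (σ (toPlane (F^[1] w)))).toReal := by
              simp [returnSum, Finset.sum_range_succ, ht]
            have h4 := hw.le_toReal (le_returnTime hc) 1
            simp only [h3, ← hk] at h2
            linarith
      · exfalso
        have h1 := hc w v (-(t₀ + s - u)) (by linarith) (by
          rw [← ha, ← Flow.map_add, neg_add_cancel, Flow.map_zero_apply])
        linarith
    refine (measure_mono hsub).trans ((measure_union_le _ _).trans (add_le_add ?_ ?_))
    · by_cases h : w ∈ A
      · have : {s | w ∈ A ∧ s ∈ Icc 0 (C * r)} = Icc 0 (C * r) := by ext; simp [h]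
        rw [this, Real.volume_Icc]
        simp [h]
      · simp [h]
    · by_cases h : F w ∈ A
      · have : {s | F w ∈ A ∧ s ∈ Icc (t - C * r) t} = Icc (t - C * r) t := by ext; simp [h]
        rw [this, Real.volume_Icc]
        simp [h]
      · simp [h]
  refine (lintegral_mono_ae hpt).trans (le_of_eq ?_)
  have hind : Measurable (A.indicator fun _ => ENNReal.ofReal (C * r)) :=
    measurable_const.indicator hA
  rw [lintegral_add_left hind, hF.lintegral_comp hind, lintegral_indicator_const hA,
    ← two_mul, ← mul_assoc]
  congr 1
  rw [mul_assoc, ENNReal.ofReal_mul (by norm_num : (0 : ℝ) ≤ 2)]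
  simp

end LorenzFlow

/-! ### Logarithmic rates along dyadic radii -/

namespace LorenzFlow

lemma coe_mul_neg_log {r : ℝ} (hr : 0 < r) (a : ℝ) :
    (a : EReal) * ((-Real.log r : ℝ) : EReal) = ENNReal.log (ENNReal.ofReal (r ^ (-a))) := by
  rw [ENNReal.log_ofReal_of_pos (Real.rpow_pos_of_pos hr _), Real.log_rpow hr, ← EReal.coe_mul]
  congr 1
  ring

/-- For `r < 1` the divisor is positive, so thresholds on the quotient become comparisons with
powers of `r`, including at `m = 0` and `m = ∞`. -/
lemma lt_log_div_neg_log_iff {r : ℝ} (hr : 0 < r) (hr1 : r < 1) (a : ℝ) (m : ℝ≥0∞) :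
    (a : EReal) < ENNReal.log m / ((-Real.log r : ℝ) : EReal) ↔ ENNReal.ofReal (r ^ (-a)) < m := by
  have hl : 0 < -Real.log r := neg_pos.2 (Real.log_neg hr hr1)
  rw [EReal.lt_div_iff (by exact_mod_cast hl) (EReal.coe_ne_top _), coe_mul_neg_log hr,
    ENNReal.log_lt_log_iff]

lemma log_div_neg_log_lt_iff {r : ℝ} (hr : 0 < r) (hr1 : r < 1) (a : ℝ) (m : ℝ≥0∞) :
    ENNReal.log m / ((-Real.log r : ℝ) : EReal) < a ↔ m < ENNReal.ofReal (r ^ (-a)) := by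
  have hl : 0 < -Real.log r := neg_pos.2 (Real.log_neg hr hr1)
  rw [EReal.div_lt_iff (by exact_mod_cast hl) (EReal.coe_ne_top _), coe_mul_neg_log hr,
    ENNReal.log_lt_log_iff]

lemma log_div_log_eq_neg (r : ℝ) (m : ℝ≥0∞) :
    ENNReal.log m / ((Real.log r : ℝ) : EReal)
      = -(ENNReal.log m / ((-Real.log r : ℝ) : EReal)) := by
  rw [EReal.coe_neg, EReal.div_eq_inv_mul, EReal.div_eq_inv_mul, EReal.inv_neg, EReal.neg_mul,
    neg_neg]

lemma lt_log_div_log_iff {r : ℝ} (hr : 0 < r) (hr1 : r < 1) (a : ℝ) (m : ℝ≥0∞) :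
    (a : EReal) < ENNReal.log m / ((Real.log r : ℝ) : EReal) ↔ m < ENNReal.ofReal (r ^ a) := by
  rw [log_div_log_eq_neg, EReal.lt_neg_comm, ← EReal.coe_neg, log_div_neg_log_lt_iff hr hr1,
    neg_neg]

lemma log_div_log_lt_iff {r : ℝ} (hr : 0 < r) (hr1 : r < 1) (a : ℝ) (m : ℝ≥0∞) :
    ENNReal.log m / ((Real.log r : ℝ) : EReal) < a ↔ ENNReal.ofReal (r ^ a) < m := by
  rw [log_div_log_eq_neg, EReal.neg_lt_comm, ← EReal.coe_neg, lt_log_div_neg_log_iff hr hr1,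
    neg_neg]

lemma eventually_pos_lt_one : ∀ᶠ r : ℝ in 𝓝[>] 0, 0 < r ∧ r < 1 :=
  Ioo_mem_nhdsGT one_pos

lemma HasLocalDimension.eventually_lt {ν : Measure E3} {x₀ : E3} {d : EReal}
    (hd : HasLocalDimension ν x₀ d) {a : ℝ} (ha : (a : EReal) < d) :
    ∀ᶠ r in 𝓝[>] 0, ν (Metric.closedBall x₀ r) < ENNReal.ofReal (r ^ a) := by
  filter_upwards [hd.eventually_const_lt ha, eventually_pos_lt_one] with r h hr
  exact (lt_log_div_log_iff hr.1 hr.2 a _).1 h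

lemma HasLocalDimension.eventually_gt {ν : Measure E3} {x₀ : E3} {d : EReal}
    (hd : HasLocalDimension ν x₀ d) {a : ℝ} (ha : d < (a : EReal)) :
    ∀ᶠ r in 𝓝[>] 0, ENNReal.ofReal (r ^ a) < ν (Metric.closedBall x₀ r) := by
  filter_upwards [hd.eventually_lt_const ha, eventually_pos_lt_one] with r h hr
  exact (log_div_log_lt_iff hr.1 hr.2 a _).1 h

/-- Small radii are comparable with the terms of a geometric sequence of ratio `1 / 2`. -/
lemma eventually_exists_half_pow {L : ℝ} (hL : 0 < L) {P : ℕ → Prop}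
    (hP : ∀ᶠ j in atTop, P j) :
    ∀ᶠ r : ℝ in 𝓝[>] 0, ∃ n, P n ∧ P (n + 1) ∧ L * (1 / 2) ^ (n + 1) < r ∧
      r ≤ L * (1 / 2) ^ n := by
  obtain ⟨J, hJ⟩ := eventually_atTop.1 hP
  have hpos : 0 < L * (1 / 2) ^ J := by positivity
  filter_upwards [Ioo_mem_nhdsGT hpos, Ioo_mem_nhdsGT hL] with r hr hrL
  obtain ⟨n, h1, h2⟩ := exists_nat_pow_near_of_lt_one (x := r / L) (y := (1 / 2 : ℝ))
    (by have := hr.1; positivity) ((div_le_one hL).2 hrL.2.le) (by norm_num) (by norm_num)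
  have hn : J ≤ n := by
    by_contra hlt
    have : (1 / 2 : ℝ) ^ J ≤ (1 / 2) ^ (n + 1) :=
      pow_le_pow_of_le_one (by norm_num) (by norm_num) (by omega)
    have h3 := this.trans_lt h1
    rw [lt_div_iff₀ hL] at h3
    have := hr.2
    linarith
  refine ⟨n, hJ n hn, hJ _ (by omega), ?_, ?_⟩
  · rw [lt_div_iff₀ hL] at h1; linarith
  · rw [div_le_iff₀ hL] at h2; linarith

lemma hittingTime_antitone (X : Flow ℝ E3) (x x₀ : E3) :
    Antitone fun r => hittingTime X r x x₀ := fun _ _ h =>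
  le_iInf₂ fun t ht => iInf₂_le t ⟨ht.1, Metric.closedBall_subset_closedBall h ht.2⟩

lemma tendsto_half_pow {L : ℝ} (hL : 0 < L) :
    Tendsto (fun j : ℕ => L * (1 / 2 : ℝ) ^ j) atTop (𝓝[>] 0) := by
  refine tendsto_nhdsWithin_iff.2 ⟨?_, Eventually.of_forall fun j => ?_⟩
  · simpa using (tendsto_pow_atTop_nhds_zero_of_lt_one (r := (1 / 2 : ℝ))
      (by norm_num) (by norm_num)).const_mul L
  · show 0 < L * (1 / 2 : ℝ) ^ j
    positivity

lemma two_rpow_pow (q : ℝ) (j : ℕ) : ((2 : ℝ) ^ q) ^ j = ((2 : ℝ) ^ j) ^ q := by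
  rw [← Real.rpow_natCast, ← Real.rpow_natCast, ← Real.rpow_mul (by norm_num),
    ← Real.rpow_mul (by norm_num), mul_comm]

lemma half_pow_rpow (q : ℝ) (j : ℕ) : ((1 / 2 : ℝ) ^ j) ^ q = ((2 : ℝ) ^ (-q)) ^ j := by
  rw [two_rpow_pow, one_div, inv_pow, Real.inv_rpow (by positivity), Real.rpow_neg (by positivity)]

/-- The room between the two exponents absorbs all multiplicative constants. -/
lemma eventually_mul_rpow_lt {M q q' : ℝ} (h : q < q') :
    ∀ᶠ r : ℝ in 𝓝[>] 0, M * r ^ q' < r ^ q := by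
  have h1 : Tendsto (fun r : ℝ => M * r ^ (q' - q)) (𝓝[>] 0) (𝓝 0) := by
    have hc : ContinuousAt (fun r : ℝ => M * r ^ (q' - q)) 0 :=
      continuousAt_const.mul (Real.continuousAt_rpow_const 0 (q' - q) (Or.inr (sub_pos.2 h).le))
    have := hc.tendsto
    rw [Real.zero_rpow (sub_pos.2 h).ne', mul_zero] at this
    exact this.mono_left nhdsWithin_le_nhds
  filter_upwards [h1.eventually_lt_const one_pos, self_mem_nhdsWithin] with r hr hr0
  have hr0 : 0 < r := hr0
  have : r ^ q' = r ^ (q' - q) * r ^ q := by rw [← Real.rpow_add hr0]; ring_nf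
  rw [this, ← mul_assoc]
  have := Real.rpow_pos_of_pos hr0 q
  nlinarith

/-- From hitting times along dyadic radii to the upper logarithmic rate. -/
lemma eventually_log_hittingTime_lt {X : Flow ℝ E3} {x x₀ : E3} {L M q q' : ℝ} (hL : 0 < L)
    (hM : 0 ≤ M) (hq0 : 0 ≤ q) (hq : q < q')
    (h : ∀ᶠ j : ℕ in atTop,
      hittingTime X (L * (1 / 2) ^ j) x x₀ ≤ ENNReal.ofReal (M * ((2 : ℝ) ^ q) ^ j)) :
    ∀ᶠ r : ℝ in 𝓝[>] 0,
      ENNReal.log (hittingTime X r x x₀) / ((-Real.log r : ℝ) : EReal) < q' := by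
  filter_upwards [eventually_exists_half_pow hL h, eventually_pos_lt_one,
    eventually_mul_rpow_lt (M := M * (2 * L) ^ q) (neg_lt_neg hq)] with r hr hr1 hlt
  obtain ⟨n, -, hn, h1, h2⟩ := hr
  rw [log_div_neg_log_lt_iff hr1.1 hr1.2]
  have hr0 := hr1.1
  -- An upper bound passes from the smaller dyadic radius, of index `n + 1`, to `r`; the lower bound
  -- uses index `n` instead.
  refine ((hittingTime_antitone X x x₀ h1.le).trans hn).trans_lt
    ((ENNReal.ofReal_lt_ofReal_iff (Real.rpow_pos_of_pos hr1.1 _)).2 (lt_of_le_of_lt ?_ hlt))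
  rw [two_rpow_pow, mul_assoc, Real.rpow_neg hr0.le, ← Real.inv_rpow hr0.le,
    ← Real.mul_rpow (by positivity) (by positivity)]
  gcongr
  have h3 : (2 : ℝ) ^ n * r ≤ L := by
    calc (2 : ℝ) ^ n * r ≤ 2 ^ n * (L * (1 / 2) ^ n) := by gcongr
      _ = L := by rw [one_div, inv_pow]; field_simp
  rw [← div_eq_mul_inv, le_div_iff₀ hr0, pow_succ]
  linarith

/-- From hitting times along dyadic radii to the lower logarithmic rate. -/
lemma eventually_lt_log_hittingTime {X : Flow ℝ E3} {x x₀ : E3} {L M q q' : ℝ} (hL : 0 < L)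
    (hM : 0 < M) (hq0 : 0 ≤ q) (hq : q' < q)
    (h : ∀ᶠ j : ℕ in atTop,
      ENNReal.ofReal (M * ((2 : ℝ) ^ q) ^ j) ≤ hittingTime X (L * (1 / 2) ^ j) x x₀) :
    ∀ᶠ r : ℝ in 𝓝[>] 0,
      (q' : EReal) < ENNReal.log (hittingTime X r x x₀) / ((-Real.log r : ℝ) : EReal) := by
  have hML : 0 < M * (L / 2) ^ q := by positivity
  filter_upwards [eventually_exists_half_pow hL h, eventually_pos_lt_one,
    eventually_mul_rpow_lt (M := (M * (L / 2) ^ q)⁻¹) (neg_lt_neg hq)] with r hr hr1 hlt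
  obtain ⟨n, hn, -, h1, h2⟩ := hr
  rw [lt_log_div_neg_log_iff hr1.1 hr1.2]
  have hr0 := hr1.1
  rw [inv_mul_lt_iff₀ hML] at hlt
  refine lt_of_lt_of_le ?_ (hn.trans (hittingTime_antitone X x x₀ h2))
  rw [ENNReal.ofReal_lt_ofReal_iff (by positivity)]
  refine hlt.trans_le ?_
  rw [two_rpow_pow, mul_assoc, Real.rpow_neg hr0.le, ← Real.inv_rpow hr0.le,
    ← Real.mul_rpow (by positivity) (by positivity)]
  gcongr
  have h3 : L ≤ (2 : ℝ) ^ (n + 1) * r := by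
    calc L = 2 ^ (n + 1) * (L * (1 / 2) ^ (n + 1)) := by rw [one_div, inv_pow]; field_simp
      _ ≤ _ := by gcongr
  rw [← div_eq_mul_inv, div_le_iff₀ hr0]
  rw [pow_succ] at h3
  linarith

end LorenzFlow

/-! ### Hitting times of the flow -/

namespace LorenzFlow

variable {X : Flow ℝ E3} {σ : ℝ × ℝ → E3} {F : Square → Square} {μ : Measure Square}

/-- Passing to the image measure `flowMeasure` requires measurable events; a countable family of
radii ensures this. -/
lemma measurableSet_eventually_nat {α : Type*} [MeasurableSpace α] {p : ℕ → α → Prop}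
    (hp : ∀ j, MeasurableSet {x | p j x}) : MeasurableSet {x | ∀ᶠ j in atTop, p j x} := by
  have : {x | ∀ᶠ j in atTop, p j x} = ⋃ J, ⋂ j, ⋂ (_ : J ≤ j), {x | p j x} := by
    ext x
    simp [eventually_atTop]
  rw [this]
  exact MeasurableSet.iUnion fun J => MeasurableSet.iInter fun j =>
    MeasurableSet.iInter fun _ => hp j

/-- A property holding along almost all orbit segments between returns holds almost everywhere for
the flow measure. -/
lemma ae_flowMeasure (hσ : IsTransversalSection X σ) (hX : IsC1Flow X) [SFinite μ] {P : E3 → Prop}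
    (hP : MeasurableSet {x | P x})
    (h : ∀ᵐ w ∂μ, ∀ s : ℝ, 0 ≤ s → ENNReal.ofReal s < returnTime X σ (σ (toPlane w)) →
      P (X s (σ (toPlane w)))) :
    ∀ᵐ x ∂(flowMeasure X σ μ), P x := by
  rw [flowMeasure, ae_map_iff hσ.continuous_flow.measurable.aemeasurable hP,
    ae_restrict_iff' (measurableSet_suspension hσ hX)]
  have := (Measure.quasiMeasurePreserving_fst (μ := μ) (ν := (volume : Measure ℝ))).ae h
  filter_upwards [this] with q hq hmem
  exact hq q.2 hmem.1 hmem.2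

/-- The points of the section on a given orbit form a null set. -/
lemma ae_forall_flow_ne (hσ : IsTransversalSection X σ) (hX : IsC1Flow X)
    [NullSingletonClass μ] (x₀ : E3) :
    ∀ᵐ w ∂μ, ∀ a : ℝ, X a (σ (toPlane w)) ≠ x₀ := by
  obtain ⟨c, hc0, hc⟩ := hσ.exists_pos_le_returns hX
  -- Section points on the orbit of `x₀` are separated by flow times of at least `c`, so `⌊a w / c⌋`
  -- tells them apart.
  have hcount : {w : Square | ∃ a : ℝ, X a (σ (toPlane w)) = x₀}.Countable := by
    choose! a ha using fun (w : Square) (hw : w ∈ {w : Square | ∃ a : ℝ,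
      X a (σ (toPlane w)) = x₀}) => hw
    have hle : ∀ v w : Square, X (a v) (σ (toPlane v)) = x₀ → X (a w) (σ (toPlane w)) = x₀ →
        a v < a w → c ≤ a w - a v := fun v w hv hw hlt => by
      refine hc v w (a w - a v) (sub_pos.2 hlt) ?_
      rw [sub_eq_neg_add, Flow.map_add, hw, ← hv, ← Flow.map_add, neg_add_cancel,
        Flow.map_zero_apply]
    refine MapsTo.countable_of_injOn (f := fun w => ⌊a w / c⌋) (t := univ) (mapsTo_univ _ _) ?_
      countable_univ
    intro v hv w hw hvw
    have h1 := Int.abs_sub_lt_one_of_floor_eq_floor hvw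
    rw [← sub_div, abs_div, abs_of_pos hc0, div_lt_one hc0, abs_lt] at h1
    have heq : a v = a w := by
      rcases lt_trichotomy (a v) (a w) with h | h | h
      · have := hle v w (ha v hv) (ha w hw) h; linarith
      · exact h
      · have := hle w v (ha w hw) (ha v hv) h; linarith
    refine hσ.injective ?_
    have h2 : X (a v) (σ (toPlane v)) = X (a v) (σ (toPlane w)) := by
      rw [ha v hv, heq, ha w hw]
    have h3 := congrArg (X (-a v)) h2
    simpa only [← Flow.map_add, neg_add_cancel, Flow.map_zero_apply] using h3
  filter_upwards [hcount.ae_notMem μ] with w hw a ha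
  exact hw ⟨a, ha⟩

/-- The orbit segment up to time `M` is compact and avoids `x₀`, hence avoids small balls around it.
-/
lemma eventually_le_hittingTime {x x₀ : E3} (h : ∀ a : ℝ, X a x ≠ x₀) (M : ℝ) :
    ∀ᶠ r : ℝ in 𝓝[>] 0, ENNReal.ofReal M ≤ hittingTime X r x x₀ := by
  have hK : IsCompact ((fun a => X a x) '' Icc 0 M) :=
    isCompact_Icc.image (X.continuous continuous_id continuous_const)
  have hx : x₀ ∈ ((fun a => X a x) '' Icc 0 M)ᶜ := by
    rintro ⟨a, -, ha⟩; exact h a ha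
  obtain ⟨ε, hε, hball⟩ := Metric.isOpen_iff.1 hK.isClosed.isOpen_compl x₀ hx
  filter_upwards [Ioo_mem_nhdsGT hε] with r hr
  refine le_iInf₂ fun t ht => ENNReal.ofReal_le_ofReal ?_
  by_contra hlt
  exact hball (Metric.closedBall_subset_ball hr.2 ht.2) ⟨t, ⟨ht.1, (not_le.1 hlt).le⟩, rfl⟩

/-- Lower bound for the hitting times from an upper bound for the measure of the balls of the
section. -/
lemma ae_eventually_le_hittingTime (hσ : IsTransversalSection X σ) (hX : IsC1Flow X)
    [IsProbabilityMeasure μ] [NullSingletonClass μ] (hF : MeasurePreserving F μ μ)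
    (hret : IsFirstReturnMap X σ F μ)
    {w₀ : Square} {t₀ : ℝ} {x₀ : E3} {C r₀ : ℝ} (hC : 0 < C) (hr₀ : 0 < r₀)
    (hbox : ∀ (w : Square) (t : ℝ), 0 ≤ t → ∀ r < r₀,
      X t (σ (toPlane w)) ∈ Metric.closedBall x₀ r →
        ∃ (v : Square) (u : ℝ), X u (σ (toPlane v)) = X t (σ (toPlane w)) ∧
          v ∈ Metric.closedBall w₀ (C * r) ∧ |u - t₀| ≤ C * r) (ht₀ : 0 ≤ t₀)
    {b β γ : ℝ} (hβ : 0 ≤ β) (hγ : 1 < γ) (hβγ : β * γ < 1)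
    (hm : ∀ᶠ j : ℕ in atTop, μ.real (Metric.closedBall w₀ ((1 / 2) ^ j)) ≤ b * β ^ j) :
    ∃ M : ℝ, 0 < M ∧ ∀ᵐ x ∂(flowMeasure X σ μ), ∀ᶠ j : ℕ in atTop,
      ENNReal.ofReal (M * γ ^ j) ≤ hittingTime X (C⁻¹ * (1 / 2) ^ j) x x₀ := by
  obtain ⟨c, hc0, hc⟩ := hσ.exists_pos_le_returns hX
  -- More than `γ ^ j` returns take more than `c * γ ^ j`; half of this absorbs the loss `s + 1`
  -- from the starting height and the box.
  refine ⟨c / 2, by positivity, ae_flowMeasure hσ hX (measurableSet_eventually_nat fun j =>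
    measurableSet_le measurable_const (measurable_hittingTime X _ x₀)) ?_⟩
  have hav := ae_eventually_forall_notMem hF
    (A := fun j : ℕ => Metric.closedBall w₀ ((1 / 2 : ℝ) ^ j))
    (fun j => Metric.isClosed_closedBall.measurableSet) hβ hγ.le hβγ hm
  filter_upwards [hav, hret.ae_followsReturns hF, ae_forall_flow_ne hσ hX x₀]
    with w hw1 hw2 hw3 s hs0 _
  have hlim := tendsto_half_pow (inv_pos.2 hC)
  have hne : ∀ a : ℝ, X a (X s (σ (toPlane w))) ≠ x₀ := fun a => by
    rw [← Flow.map_add]; exact hw3 _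
  -- As `u ≤ t₀ + 1`, hitting times of at least `t₀ + 2` make `t + s - u` nonnegative, so it is a
  -- forward return.
  have hfar := hlim.eventually (eventually_le_hittingTime hne (t₀ + 2))
  have hsmall := hlim.eventually (Ioo_mem_nhdsGT hr₀)
  have hbig : ∀ᶠ j : ℕ in atTop, (s + 1) * (2 / c) ≤ γ ^ j :=
    (tendsto_pow_atTop_atTop_of_one_lt hγ).eventually_ge_atTop _
  filter_upwards [hw1, hfar, hsmall, hbig] with j h1 h2 h3 h4
  refine le_iInf₂ fun t ht => ENNReal.ofReal_le_ofReal ?_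
  have hpow : (1 / 2 : ℝ) ^ j ≤ 1 := pow_le_one₀ (by norm_num) (by norm_num)
  have hmem := ht.2
  rw [← Flow.map_add] at hmem
  obtain ⟨v, u, hvu, hv, hu⟩ := hbox w (t + s) (by linarith [ht.1]) _ h3.2 hmem
  rw [mul_inv_cancel_left₀ hC.ne'] at hv hu
  rw [abs_le] at hu
  have hat : X (t + s - u) (σ (toPlane w)) = σ (toPlane v) := by
    rw [sub_eq_neg_add, Flow.map_add, ← hvu, ← Flow.map_add, neg_add_cancel, Flow.map_zero_apply]
  have htbig : t₀ + 2 ≤ t := by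
    have : ENNReal.ofReal (t₀ + 2) ≤ ENNReal.ofReal t := h2.trans (iInf₂_le t ht)
    exact (ENNReal.ofReal_le_ofReal_iff ht.1).1 this
  obtain ⟨k, hk, hvk⟩ := hw2.exists_eq_returnSum hσ hc0 (le_returnTime hc)
    (by linarith : 0 ≤ t + s - u) hat
  have hkbig : γ ^ j < k := by
    by_contra hle
    exact h1 k (not_lt.1 hle) (hvk ▸ hv)
  have hsum := hw2.mul_le_returnSum (le_returnTime hc) k
  have h5 : c * γ ^ j ≤ c * k := by gcongr
  rw [← mul_div_assoc, div_le_iff₀ hc0] at h4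
  linarith

/-- A Lipschitz bump function at `w₀` of radius `2⁻ʲ`. -/
noncomputable def bump (w₀ : Square) (j : ℕ) (w : Square) : ℝ := max 0 (1 - 2 ^ j * dist w w₀)

lemma bump_nonneg (w₀ : Square) (j : ℕ) (w : Square) : 0 ≤ bump w₀ j w := le_max_left _ _

lemma bump_le_one (w₀ : Square) (j : ℕ) (w : Square) : bump w₀ j w ≤ 1 :=
  max_le zero_le_one (by have : 0 ≤ 2 ^ j * dist w w₀ := by positivity
                         linarith)

lemma lipschitzWith_bump (w₀ : Square) (j : ℕ) : LipschitzWith (2 ^ j) (bump w₀ j) := by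
  have : LipschitzWith (2 ^ j) fun w : Square => 1 - 2 ^ j * dist w w₀ := by
    refine LipschitzWith.of_dist_le_mul fun v w => ?_
    rw [Real.dist_eq]
    have : (1 - 2 ^ j * dist v w₀) - (1 - 2 ^ j * dist w w₀)
        = 2 ^ j * (dist w w₀ - dist v w₀) := by ring
    rw [this, abs_mul, abs_of_pos (by positivity)]
    push_cast
    gcongr
    rw [dist_comm v w]
    exact abs_dist_sub_le w v w₀
  exact this.const_max 0

lemma mem_closedBall_of_bump_pos {w₀ : Square} {j : ℕ} {w : Square} (h : 0 < bump w₀ j w) :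
    w ∈ Metric.closedBall w₀ ((1 / 2) ^ j) := by
  rcases lt_max_iff.1 h with h | h
  · exact absurd h (lt_irrefl 0)
  · have hp : (1 / 2 : ℝ) ^ j = 1 / 2 ^ j := one_div_pow 2 j
    rw [Metric.mem_closedBall, hp, le_div_iff₀ (by positivity)]
    linarith

/-- The bump is at least `1 / 2` on the ball of half its radius, whence the index `j + 1`. -/
lemma half_measure_le_integral_bump [IsProbabilityMeasure μ] (w₀ : Square) (j : ℕ) :
    1 / 2 * μ.real (Metric.closedBall w₀ ((1 / 2) ^ (j + 1))) ≤ ∫ w, bump w₀ j w ∂μ := by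
  have hi : Integrable (bump w₀ j) μ := Integrable.of_bound
    (lipschitzWith_bump w₀ j).continuous.measurable.aestronglyMeasurable 1
    (Eventually.of_forall fun w => by
      rw [Real.norm_eq_abs, abs_of_nonneg (bump_nonneg _ _ _)]; exact bump_le_one _ _ _)
  have := mul_meas_ge_le_integral_of_nonneg (μ := μ) (Eventually.of_forall (bump_nonneg w₀ j)) hi
    (1 / 2)
  refine le_trans ?_ this
  refine mul_le_mul_of_nonneg_left (measureReal_mono (fun w hw => ?_) (measure_ne_top _ _))
    (by norm_num)
  change 1 / 2 ≤ max 0 (1 - 2 ^ j * dist w w₀)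
  refine le_trans ?_ (le_max_right _ _)
  have h1 : dist w w₀ ≤ (1 / 2) ^ (j + 1) := hw
  have h2 : (2 : ℝ) ^ j * dist w w₀ ≤ 2 ^ j * (1 / 2) ^ (j + 1) := by gcongr
  have h3 : (2 : ℝ) ^ j * (1 / 2) ^ (j + 1) = 1 / 2 := by
    rw [pow_succ, ← mul_assoc, ← mul_pow]; norm_num
  linarith

/-- Upper bound for the hitting times from decay of correlations and a lower bound for the measure
of the balls of the section. -/
lemma ae_eventually_hittingTime_le (hσ : IsTransversalSection X σ) (hX : IsC1Flow X)
    {T : Interval → Interval} {G : Square → Interval} (hL : IsLorenzLikeMap T G μ)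
    (hret : IsFirstReturnMap X σ (skewMap T G) μ)
    (hint : ∫⁻ w, returnTime X σ (σ (toPlane w)) ∂μ < ∞)
    (w₀ : Square) {t₀ : ℝ} (ht₀ : 0 ≤ t₀)
    {b β η : ℝ} (hb : 0 < b) (hβ : 0 < β) (hβ1 : β ≤ 1) (hη : 1 < β * η)
    (hm : ∀ᶠ j : ℕ in atTop, b * β ^ j ≤ μ.real (Metric.closedBall w₀ ((1 / 2) ^ j))) :
    ∃ L : ℝ, 0 < L ∧ ∀ᵐ x ∂(flowMeasure X σ μ), ∀ᶠ j : ℕ in atTop,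
      hittingTime X (L * (1 / 2) ^ j) x (X t₀ (σ (toPlane w₀)))
        ≤ ENNReal.ofReal ((2 + t₀) * η ^ j) := by
  have := hL.isProbability
  have hF := hL.measurePreserving
  set F := skewMap T G with hFdef
  obtain ⟨L, r₁, hL0, hr₁, hflow⟩ := hσ.exists_mem_closedBall hX w₀ t₀
  refine ⟨L, hL0, ae_flowMeasure hσ hX (measurableSet_eventually_nat fun j =>
    measurableSet_le (measurable_hittingTime X _ _) measurable_const) ?_⟩
  obtain ⟨D, ρ, hD, hρ0, hρ1, hdec⟩ := hL.exists_decay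
  have hη' : 1 / β < η := (div_lt_iff₀' hβ).2 hη
  -- Hitting takes at most about `γ ^ j` returns, and the slack `(η / γ) ^ j` pays for their total
  -- duration.
  obtain ⟨γ, hγ1, hγη⟩ := exists_between hη'
  have hβγ : 1 < β * γ := (div_lt_iff₀' hβ).1 hγ1
  have hγ : 1 < γ := lt_of_le_of_lt ((one_le_div hβ).2 hβ1) hγ1
  have hγ0 : 0 < γ := zero_lt_one.trans hγ
  have hδ : 1 < η / γ := (one_lt_div hγ0).2 hγη
  set N : ℕ → ℕ := fun j => ⌈γ ^ j⌉₊ with hN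
  have hNpos : ∀ j, 0 < N j := fun j => Nat.ceil_pos.2 (by positivity)
  have hhit : ∀ᵐ w ∂μ, ∀ᶠ j in atTop, ∃ k < N j, 0 < bump w₀ j (F^[k] w) := by
    refine ae_eventually_exists_pos hF
      (fun j => (lipschitzWith_bump w₀ j).continuous.measurable) (bump_nonneg w₀) (bump_le_one w₀)
      (c₁ := D * 2) (c₂ := b * β / 2) (by positivity) (by positivity) hρ0 hρ1 hβ hγ0 hβγ ?_ ?_ N
      (fun j => Nat.le_ceil _)
    · intro j n
      refine (le_abs_self _).trans ((hdec _ _ (lipschitzWith_bump w₀ j) (bump_nonneg w₀ j)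
        (bump_le_one w₀ j) n).trans ?_)
      have h1 : (1 : ℝ) ≤ 2 ^ j := one_le_pow₀ one_le_two
      rw [mul_assoc D 2]
      push_cast
      gcongr
      linarith
    · filter_upwards [(tendsto_add_atTop_nat 1).eventually hm] with j hj
      refine le_trans ?_ (half_measure_le_integral_bump w₀ j)
      rw [pow_succ] at hj
      linarith
  have hsum := ae_eventually_sum_le hF (hσ.measurable_returnTime hX) hint.ne hδ hNpos
  -- The hit is taken along the orbit of `F w`, so it occurs at return `k + 1 ≥ 1`, after the
  -- starting height `s`, while `k + 1 ≤ N j` still holds.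
  filter_upwards [hF.quasiMeasurePreserving.ae hhit, hsum, hret.ae_followsReturns hF]
    with w hw1 hw2 hw3 s hs0 hst
  have hsmall := (tendsto_half_pow one_pos).eventually (Ioo_mem_nhdsGT hr₁)
  filter_upwards [hw1, hw2, hsmall] with j h1 h2 h3
  rw [one_mul] at h3
  obtain ⟨k, hk, hpos⟩ := h1
  rw [← Function.iterate_succ_apply] at hpos
  have hball := mem_closedBall_of_bump_pos hpos
  have hin := hflow _ h3.2 _ hball t₀ (by rw [sub_self, abs_zero]; positivity)
  rw [← hw3.flow_returnSum, ← Flow.map_add] at hin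
  set S := returnSum X σ F (k + 1) w with hS
  have hsS : s ≤ S := by
    have hs1 : s < (returnTime X σ (σ (toPlane w))).toReal :=
      (ENNReal.ofReal_lt_iff_lt_toReal hs0 (hw3 0).1.ne).1 hst
    have hs2 := returnSum_mono (X := X) (σ := σ) (F := F) w (show 1 ≤ k + 1 by omega)
    have hs3 : returnSum X σ F 1 w = (returnTime X σ (σ (toPlane w))).toReal := by
      simp [returnSum]
    simp only [hs3] at hs2
    linarith
  have hSle : S ≤ (η / γ) ^ j * N j := by
    have hs2 := returnSum_mono (X := X) (σ := σ) (F := F) w (show k + 1 ≤ N j by omega)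
    refine hs2.trans ?_
    have hfin : ∀ i ∈ Finset.range (N j), returnTime X σ (σ (toPlane (F^[i] w))) ≠ ∞ :=
      fun i _ => (hw3 i).1.ne
    simp only [returnSum]
    rw [← ENNReal.toReal_sum hfin]
    exact (ENNReal.toReal_le_of_le_ofReal (by positivity) h2.le)
  have hmem : X (S + t₀ - s) (X s (σ (toPlane w)))
      ∈ Metric.closedBall (X t₀ (σ (toPlane w₀))) (L * (1 / 2) ^ j) := by
    rw [← Flow.map_add, sub_add_cancel, add_comm]
    exact hin
  have htime : S + t₀ - s ≤ (2 + t₀) * η ^ j := by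
    have hNle : (N j : ℝ) ≤ 2 * γ ^ j := by
      have := Nat.ceil_lt_add_one (show 0 ≤ γ ^ j by positivity)
      have h1 : 1 ≤ γ ^ j := one_le_pow₀ hγ.le
      simp only [hN]
      linarith
    have hη0 : 0 < η := hγ0.trans hγη
    have h5 : (η / γ) ^ j * N j ≤ 2 * η ^ j := by
      calc (η / γ) ^ j * N j ≤ (η / γ) ^ j * (2 * γ ^ j) := by gcongr
        _ = 2 * η ^ j := by rw [div_pow]; field_simp
    have h6 : 1 ≤ η ^ j := one_le_pow₀ (hγ.trans hγη).le
    have h7 : t₀ ≤ t₀ * η ^ j := le_mul_of_one_le_right ht₀ h6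
    linarith
  exact (iInf₂_le (S + t₀ - s) ⟨by linarith, hmem⟩).trans (ENNReal.ofReal_le_ofReal htime)

/-- Upper bound for the measure of balls of the section in terms of the local dimension of the flow
measure. -/
lemma eventually_measureReal_closedBall_le [IsProbabilityMeasure μ] {ν : Measure E3} {x₀ : E3}
    {d : EReal} (hd : HasLocalDimension ν x₀ d) {w₀ : Square} {L r₁ : ℝ} (hL : 0 < L)
    (hr₁ : 0 < r₁) (hle : ∀ r, 0 < r → r < r₁ → ENNReal.ofReal r * μ (Metric.closedBall w₀ r) ≤
      ν (Metric.closedBall x₀ (L * r))) {q : ℝ} (hq : ((q + 1 : ℝ) : EReal) < d) :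
    ∀ᶠ j : ℕ in atTop, μ.real (Metric.closedBall w₀ ((1 / 2) ^ j))
      ≤ L ^ (q + 1) * ((2 : ℝ) ^ (-q)) ^ j := by
  have h1 := (tendsto_half_pow hL).eventually (hd.eventually_lt hq)
  have h2 := (tendsto_half_pow one_pos).eventually (Ioo_mem_nhdsGT hr₁)
  filter_upwards [h1, h2] with j h1 h2
  rw [one_mul] at h2
  have h3 := (hle _ h2.1 h2.2).trans h1.le
  rw [← half_pow_rpow]
  set r : ℝ := (1 / 2) ^ j with hr
  have hr0 : 0 < r := h2.1
  have h4 : r * μ.real (Metric.closedBall w₀ r) ≤ (L * r) ^ (q + 1) := by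
    have := ENNReal.toReal_mono ENNReal.ofReal_ne_top h3
    rwa [ENNReal.toReal_mul, ENNReal.toReal_ofReal hr0.le, ENNReal.toReal_ofReal (by positivity)]
      at this
  rw [Real.mul_rpow hL.le hr0.le, Real.rpow_add hr0, Real.rpow_one] at h4
  have h5 : r * μ.real (Metric.closedBall w₀ r) ≤ r * (L ^ (q + 1) * r ^ q) := by linarith
  exact le_of_mul_le_mul_left h5 hr0

/-- Lower bound for the measure of balls of the section in terms of the local dimension of the flow
measure. -/
lemma eventually_le_measureReal_closedBall [IsProbabilityMeasure μ] {ν : Measure E3} {x₀ : E3}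
    {d : EReal} (hd : HasLocalDimension ν x₀ d) {w₀ : Square} {C r₂ : ℝ} (hC : 0 < C)
    (hr₂ : 0 < r₂) (hle : ∀ r, 0 < r → r < r₂ → ν (Metric.closedBall x₀ r)
      ≤ ENNReal.ofReal (2 * C * r) * μ (Metric.closedBall w₀ (C * r))) {q : ℝ}
    (hq : d < ((q + 1 : ℝ) : EReal)) :
    ∀ᶠ j : ℕ in atTop, (C⁻¹) ^ (q + 1) / 2 * ((2 : ℝ) ^ (-q)) ^ j
      ≤ μ.real (Metric.closedBall w₀ ((1 / 2) ^ j)) := by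
  have h1 := (tendsto_half_pow (inv_pos.2 hC)).eventually (hd.eventually_gt hq)
  have h2 := (tendsto_half_pow (inv_pos.2 hC)).eventually (Ioo_mem_nhdsGT hr₂)
  filter_upwards [h1, h2] with j h1 h2
  have h3 := h1.le.trans (hle _ h2.1 h2.2)
  rw [← half_pow_rpow]
  rw [mul_inv_cancel_left₀ hC.ne', mul_assoc, mul_inv_cancel_left₀ hC.ne'] at h3
  have hr0 : 0 < (1 / 2 : ℝ) ^ j := by positivity
  set r : ℝ := (1 / 2) ^ j with hr
  have h4 : (C⁻¹ * r) ^ (q + 1) ≤ 2 * r * μ.real (Metric.closedBall w₀ r) := by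
    have := ENNReal.toReal_mono (ENNReal.mul_ne_top ENNReal.ofReal_ne_top (measure_ne_top _ _)) h3
    rwa [ENNReal.toReal_mul, ENNReal.toReal_ofReal (by positivity),
      ENNReal.toReal_ofReal (by positivity)] at this
  rw [Real.mul_rpow (by positivity) hr0.le, Real.rpow_add hr0, Real.rpow_one] at h4
  have h5 : r * (C⁻¹ ^ (q + 1) / 2 * r ^ q) ≤ r * μ.real (Metric.closedBall w₀ r) := by linarith
  exact le_of_mul_le_mul_left h5 hr0

/-- The exponent in a power lower bound for the measure of balls is nonnegative. -/
lemma nonneg_of_eventually_le_measureReal [IsProbabilityMeasure μ] {w₀ : Square} {b q : ℝ}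
    (hb : 0 < b) (h : ∀ᶠ j : ℕ in atTop, b * ((2 : ℝ) ^ (-q)) ^ j
      ≤ μ.real (Metric.closedBall w₀ ((1 / 2) ^ j))) : 0 ≤ q := by
  by_contra hq
  have h1 : (1 : ℝ) < 2 ^ (-q) := Real.one_lt_rpow one_lt_two (by linarith)
  have h2 := (tendsto_pow_atTop_atTop_of_one_lt h1).eventually_gt_atTop (1 / b)
  obtain ⟨j, h3, h4⟩ := (h.and h2).exists
  rw [div_lt_iff₀ hb] at h4
  have : μ.real (Metric.closedBall w₀ ((1 / 2) ^ j)) ≤ 1 := measureReal_le_one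
  linarith

/-- The logarithm law for hitting times of balls around a regular point. -/
theorem tendsto_log_hittingTime
    (X : Flow ℝ E3) (hX : IsC1Flow X)
    (σ : ℝ × ℝ → E3) (hσ : IsTransversalSection X σ)
    (T : Interval → Interval)
    (G : Square → Interval)
    (μ : Measure Square)
    (hF : IsLorenzLikeMap T G μ)
    (hret : IsFirstReturnMap X σ (skewMap T G) μ)
    (hint : ∫⁻ w, returnTime X σ (σ (toPlane w)) ∂μ < ⊤)
    (x₀ : E3) (hx₀ : IsRegularPoint X σ x₀)
    (d : EReal) (hd : HasLocalDimension (flowMeasure X σ μ) x₀ d) :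
    ∀ᵐ x ∂(flowMeasure X σ μ),
      Tendsto
        (fun r : ℝ => ENNReal.log (hittingTime X r x x₀) / ((-Real.log r : ℝ) : EReal))
        (𝓝[>] 0) (𝓝 (d - 1)) := by
  have := hF.isProbability
  have : NullSingletonClass μ := ⟨hF.measure_singleton⟩
  have hmp := hF.measurePreserving
  obtain ⟨w₀, t₀, ht₀, rfl, C, r₀, hC, hr₀, hbox⟩ := hx₀.exists_flowBox
  obtain ⟨L, r₁, hL, hr₁, hlow⟩ := exists_mul_measure_le_flowMeasure hσ hX hmp hret w₀ ht₀
  obtain ⟨r₂, hr₂, hup⟩ := flowMeasure_closedBall_le hσ hX hmp hret ht₀ hC hr₀ hbox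
  have hlower : ∀ q : ℚ, ((q : ℝ) : EReal) < d - 1 → ∀ᵐ x ∂(flowMeasure X σ μ),
      ∀ᶠ r : ℝ in 𝓝[>] 0, ((q : ℝ) : EReal) <
        ENNReal.log (hittingTime X r x (X t₀ (σ (toPlane w₀)))) / ((-Real.log r : ℝ) : EReal) := by
    intro q hq
    -- The union bound needs `γ > 1`. For negative `q` it is enough that hitting times eventually
    -- exceed `1`.
    rcases lt_or_ge q 0 with hneg | hnn
    · have hfar : ∀ᵐ x ∂(flowMeasure X σ μ), ∀ᶠ j : ℕ in atTop,
          ENNReal.ofReal (1 * ((2 : ℝ) ^ (0 : ℝ)) ^ j)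
            ≤ hittingTime X (1 * (1 / 2) ^ j) x (X t₀ (σ (toPlane w₀))) := by
        refine ae_flowMeasure hσ hX (measurableSet_eventually_nat fun j =>
          measurableSet_le measurable_const (measurable_hittingTime X _ _)) ?_
        filter_upwards [ae_forall_flow_ne hσ hX (X t₀ (σ (toPlane w₀)))] with w hw s _ _
        simp only [Real.rpow_zero, one_pow, mul_one]
        exact (tendsto_half_pow one_pos).eventually (eventually_le_hittingTime
          (fun a => by rw [← Flow.map_add]; exact hw _) 1)
      filter_upwards [hfar] with x hx
      exact eventually_lt_log_hittingTime one_pos one_pos le_rfl (by exact_mod_cast hneg) hx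
    · obtain ⟨q₂, hq₂, hq₂d⟩ := EReal.lt_iff_exists_real_btwn.1 hq
      have hqq₂ : (q : ℝ) < q₂ := EReal.coe_lt_coe_iff.1 hq₂
      obtain ⟨q₁, hqq₁, hq₁⟩ := exists_between hqq₂
      have hq0 : (0 : ℝ) ≤ q := by exact_mod_cast hnn
      have hd1 : ((q₂ + 1 : ℝ) : EReal) < d := by
        rw [EReal.lt_sub_iff_add_lt (Or.inl (show (1 : EReal) ≠ ⊥ from EReal.coe_ne_bot 1))
        (Or.inl (show (1 : EReal) ≠ ⊤ from EReal.coe_ne_top 1))]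
          at hq₂d
        exact_mod_cast hq₂d
      have hm := eventually_measureReal_closedBall_le hd hL hr₁ hlow hd1
      obtain ⟨M, hM, h⟩ := ae_eventually_le_hittingTime hσ hX hmp hret hC hr₀ hbox ht₀
        (β := 2 ^ (-q₂)) (γ := 2 ^ q₁) (by positivity)
        (Real.one_lt_rpow one_lt_two (by linarith))
        (by rw [← Real.rpow_add two_pos]
            exact Real.rpow_lt_one_of_one_lt_of_neg one_lt_two (by linarith)) hm
      filter_upwards [h] with x hx
      exact eventually_lt_log_hittingTime (inv_pos.2 hC) hM (by linarith) hqq₁ hx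
  have hupper : ∀ q : ℚ, d - 1 < ((q : ℝ) : EReal) → ∀ᵐ x ∂(flowMeasure X σ μ),
      ∀ᶠ r : ℝ in 𝓝[>] 0,
        ENNReal.log (hittingTime X r x (X t₀ (σ (toPlane w₀)))) / ((-Real.log r : ℝ) : EReal)
          < ((q : ℝ) : EReal) := by
    intro q hq
    obtain ⟨q₂, hq₂d, hq₂⟩ := EReal.lt_iff_exists_real_btwn.1 hq
    have hqq₂ : q₂ < (q : ℝ) := EReal.coe_lt_coe_iff.1 hq₂
    obtain ⟨q₁, hq₁, hqq₁⟩ := exists_between hqq₂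
    have hd1 : d < ((q₂ + 1 : ℝ) : EReal) := by
      rw [EReal.sub_lt_iff (Or.inl (show (1 : EReal) ≠ ⊥ from EReal.coe_ne_bot 1))
        (Or.inl (show (1 : EReal) ≠ ⊤ from EReal.coe_ne_top 1))] at hq₂d
      exact_mod_cast hq₂d
    have hm := eventually_le_measureReal_closedBall hd hC hr₂ hup hd1
    have hb : 0 < C⁻¹ ^ (q₂ + 1) / 2 := by positivity
    -- Ball measures are at most `1`, which forces `q₂ ≥ 0` and hence `β ≤ 1`.
    have hq₂0 := nonneg_of_eventually_le_measureReal hb hm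
    obtain ⟨L', hL', h⟩ := ae_eventually_hittingTime_le hσ hX hF hret hint w₀ ht₀
      (β := 2 ^ (-q₂)) (η := 2 ^ q₁) hb (by positivity)
      (Real.rpow_le_one_of_one_le_of_nonpos one_le_two (by linarith))
      (by rw [← Real.rpow_add two_pos]
          exact Real.one_lt_rpow one_lt_two (by linarith)) hm
    filter_upwards [h] with x hx
    exact eventually_log_hittingTime_lt hL' (by positivity) (by linarith) hqq₁ hx
  have hlower' := ae_all_iff.2 fun q : ℚ => eventually_imp_distrib_left.2 (hlower q)
  have hupper' := ae_all_iff.2 fun q : ℚ => eventually_imp_distrib_left.2 (hupper q)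
  filter_upwards [hlower', hupper'] with x h1 h2
  refine tendsto_order.2 ⟨fun a ha => ?_, fun a ha => ?_⟩
  · obtain ⟨q, hq1, hq2⟩ := EReal.exists_rat_btwn_of_lt ha
    exact (h1 q hq2).mono fun r hr => hq1.trans hr
  · obtain ⟨q, hq1, hq2⟩ := EReal.exists_rat_btwn_of_lt ha
    exact (h2 q hq1).mono fun r hr => hr.trans hq2

end LorenzFlow

theorem theorem6p3
    (X : Flow ℝ LorenzFlow.E3) (hX : LorenzFlow.IsC1Flow X)
    (σ : ℝ × ℝ → LorenzFlow.E3) (hσ : LorenzFlow.IsTransversalSection X σ)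
    (T : LorenzFlow.Interval → LorenzFlow.Interval)
    (G : LorenzFlow.Square → LorenzFlow.Interval)
    (μ : MeasureTheory.Measure LorenzFlow.Square)
    (hF : LorenzFlow.IsLorenzLikeMap T G μ)
    (hret : LorenzFlow.IsFirstReturnMap X σ (LorenzFlow.skewMap T G) μ)
    (hint : ∫⁻ w, LorenzFlow.returnTime X σ (σ (LorenzFlow.toPlane w)) ∂μ < ⊤)
    (x₀ : LorenzFlow.E3) (hx₀ : LorenzFlow.IsRegularPoint X σ x₀)
    (d : EReal) (hd : LorenzFlow.HasLocalDimension (LorenzFlow.flowMeasure X σ μ) x₀ d) :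
    ∀ᵐ x ∂(LorenzFlow.flowMeasure X σ μ),
      Filter.Tendsto
        (fun r : ℝ => ENNReal.log (LorenzFlow.hittingTime X r x x₀) / ((-Real.log r : ℝ) : EReal))
        (nhdsWithin 0 (Set.Ioi 0)) (nhds (d - 1)) :=
  LorenzFlow.tendsto_log_hittingTime X hX σ hσ T G μ hF hret hint x₀ hx₀ d hd
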